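/- Let $d\ge 2$, let $B\subset\mathbb R^d$ be the open unit ball and $L^2_\diamond(\partial B)=\{g\in L^2(\partial B):\langle g,1\rangle_{L^2(\partial B)}=0\}$; all spaces are complex. For $\gamma\in L^\infty(B)$ near $1$, let $\Lambda(\gamma)\in\mathscr L(L^2_\diamond(\partial B))$ be the Neumann-to-Dirichlet map $f\mapsto u|_{\partial B}$, where $u\in H^1(B)$ with $u|_{\partial B}\in L^2_\diamond(\partial B)$ is the weak solution of $-\mathrm{div}(\gamma\nabla u)=0$ in $B$, $\gamma\,\partial u/\partial r=f$ on $\partial B$. Let $\mathcal R\subset L^2(B)$ be the subspace of radial perturbations, i.e. of those $\eta$ with $\eta(x)=\eta(\|x\|)$ for almost every $x\in B$. Then $\Lambda$ is Fréchet differentiable at $\gamma=1$ (with complex-valued perturbations $\eta\in L^\infty(B)$), and there is exactly one bounded linear operator $F\in\mathscr L\big(\mathcal R,\mathscr L(L^2_\diamond(\partial B))\big)$ with $F\eta=D\Lambda(1;\eta)$ for all $\eta\in\mathcal R\cap L^\infty(B)$. For $\ell\ge1$ let $\Psi_\ell$ be the orthogonal projection of $L^2_\diamond(\partial B)$ onto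 the spherical harmonics of degree $\ell$ (the restrictions to $\partial B$ of the complex harmonic homogeneous polynomials of degree $\ell$), and for $\eta\in\mathcal R$ put $$\lambda_\ell(\eta)=\sum_{k=0}^{2\ell-2}(-1)^{k+1}a_k(\eta)\,\frac{\sqrt{2k+d}}{\ell}\,\frac{(2\ell-2+d)!\,(2\ell-2)!}{(2\ell-2+d+k)!\,(2\ell-2-k)!},\qquad a_k(\eta)=\int_0^1\eta(r)P_k(r)\,r^{d-1}\,dr,$$ $$P_k(r)=\sqrt{2k+d}\,\sum_{q=0}^k(-1)^q\binom kq\binom{k+q+d-1}{k}r^q .$$ Then, for every $N$, $F_N\eta:=\sum_{\ell=1}^N\lambda_\ell(\eta)\Psi_\ell$ defines a finite-rank operator $F_N\in\mathscr L\big(\mathcal R,\mathscr L(L^2_\diamond(\partial B))\big)$, and $\|F-F_N\|\to0$ in the operator norm as $N\to\infty$. In particular $F$ is a compact operator from $\mathcal R$ to $\mathscr L(L^2_\diamond(\partial B))$. -/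

import Mathlib

open MeasureTheory Filter Topology
open scoped ENNReal ContDiff

set_option maxSynthPendingDepth 3

noncomputable section

namespace EIT

/-! ### The unit ball, its boundary, and the `L²` spaces -/

/-- The Euclidean space `ℝ^d`. -/
abbrev Space (d : ℕ) := EuclideanSpace ℝ (Fin d)

/-- Lebesgue measure on the open unit ball `B ⊂ ℝ^d`. -/
abbrev ballMeasure (d : ℕ) : Measure (Space d) :=
  volume.restrict (Metric.ball (0 : Space d) 1)

/-- The unit sphere `∂B`. -/
abbrev Sph (d : ℕ) := Metric.sphere (0 : Space d) 1

/-- The surface measure on `∂B`. -/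
abbrev surfMeasure (d : ℕ) : Measure (Sph d) :=
  (volume : Measure (Space d)).toSphere

instance (d : ℕ) : IsFiniteMeasure (ballMeasure d) :=
  ⟨by simpa using measure_ball_lt_top⟩

/-- `L²(B)`, with complex scalars. -/
abbrev L2Ball (d : ℕ) : Type := ↥(Lp ℂ 2 (ballMeasure d))

/-- Square-integrable complex vector fields on `B`. -/
abbrev L2BallVec (d : ℕ) : Type := ↥(Lp (EuclideanSpace ℂ (Fin d)) 2 (ballMeasure d))

/-- `L^∞(B)`, with complex scalars. -/
abbrev LinfBall (d : ℕ) : Type := ↥(Lp ℂ ∞ (ballMeasure d))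

/-- `L²(∂B)`, with complex scalars. -/
abbrev L2Sph (d : ℕ) : Type := ↥(Lp ℂ 2 (surfMeasure d))

/-- `L²_⋄(∂B)`: the functions in `L²(∂B)` that are orthogonal to the constants. -/
def meanZero (d : ℕ) : Submodule ℂ (L2Sph d) :=
  (Submodule.span ℂ {Lp.const 2 (surfMeasure d) (1 : ℂ)})ᗮ

abbrev L2SphZero (d : ℕ) := ↥(meanZero d)

/-- The constant conductivity `1`. -/
def oneCond (d : ℕ) : LinfBall d := Lp.const ∞ (ballMeasure d) (1 : ℂ)

/-! ### `H¹(B)`, traces, and the Neumann-to-Dirichlet map -/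

/-- The gradient of a (real-differentiable) complex-valued function on `ℝ^d`. -/
def grad {d : ℕ} (φ : Space d → ℂ) (x : Space d) : EuclideanSpace ℂ (Fin d) :=
  WithLp.toLp 2 fun i => fderiv ℝ φ x (EuclideanSpace.single i (1 : ℝ))

/-- `G` is the weak gradient of `u` in `B`. -/
def IsWeakGradient {d : ℕ} (u : L2Ball d) (G : L2BallVec d) : Prop :=
  ∀ φ : Space d → ℂ, ContDiff ℝ ∞ φ → HasCompactSupport φ →
    tsupport φ ⊆ Metric.ball (0 : Space d) 1 →
    ∀ i : Fin d, ∫ x, u x * grad φ x i ∂(ballMeasure d) = - ∫ x, G x i * φ x ∂(ballMeasure d)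

/-- `g` is the trace on `∂B` of the function `u ∈ H¹(B)` with weak gradient `G`: the trace
operator is the continuous extension to `H¹(B)` of the restriction to `∂B` of functions that
are smooth up to the boundary. -/
def IsTrace {d : ℕ} (u : L2Ball d) (G : L2BallVec d) (g : L2Sph d) : Prop :=
  ∃ φ : ℕ → Space d → ℂ, (∀ n, ContDiff ℝ ∞ (φ n)) ∧
    Tendsto (fun n => eLpNorm (fun x => φ n x - u x) 2 (ballMeasure d)) atTop (𝓝 0) ∧
    Tendsto (fun n => eLpNorm (fun x => grad (φ n) x - G x) 2 (ballMeasure d)) atTop (𝓝 0) ∧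
    Tendsto (fun n => eLpNorm (fun θ : Sph d => φ n θ - g θ) 2 (surfMeasure d)) atTop (𝓝 0)

/-- `u ∈ H¹(B)`, with weak gradient `G` and boundary trace `g`. -/
structure IsH1 {d : ℕ} (u : L2Ball d) (G : L2BallVec d) (g : L2Sph d) : Prop where
  weakGradient : IsWeakGradient u G
  trace : IsTrace u G g

/-- `u ∈ H¹_⋄(B)`, with weak gradient `G` and trace `g ∈ L²_⋄(∂B)`, is a weak solution of
`-div(γ ∇u) = 0` in `B`, `γ ∂u/∂r = f` on `∂B`:
`∫_B γ ∇u · conj(∇v) dx = ∫_{∂B} f conj(v) dS` for all `v ∈ H¹(B)`. -/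
structure IsWeakSolution {d : ℕ} (γ : LinfBall d) (f : L2SphZero d)
    (u : L2Ball d) (G : L2BallVec d) (g : L2SphZero d) : Prop where
  isH1 : IsH1 u G (g : L2Sph d)
  weakForm : ∀ (v : L2Ball d) (Gv : L2BallVec d) (gv : L2Sph d), IsH1 v Gv gv →
    ∫ x, γ x * inner ℂ (Gv x) (G x) ∂(ballMeasure d) =
      ∫ θ, inner ℂ (gv θ) ((f : L2Sph d) θ) ∂(surfMeasure d)

/-- `A` is the Neumann-to-Dirichlet map of the conductivity `γ`: for every current density `f`,
a weak solution exists, and `A f` is the one and only boundary potential of weak solutions. -/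
def IsNDMap {d : ℕ} (γ : LinfBall d) (A : L2SphZero d →L[ℂ] L2SphZero d) : Prop :=
  ∀ f g : L2SphZero d, (∃ u G, IsWeakSolution γ f u G g) ↔ g = A f

open Classical in
/-- The forward map `γ ↦ Λ(γ)`, with value `0` at those `γ` that have no
Neumann-to-Dirichlet map in `ℒ(L²_⋄(∂B))`. -/
def ndMap (d : ℕ) (γ : LinfBall d) : L2SphZero d →L[ℂ] L2SphZero d :=
  if h : ∃ A, IsNDMap γ A then h.choose else 0

/-! ### Radial perturbations -/

/-- The space `ℛ` of radial perturbations: the `η ∈ L²(B)` with `η(x) = h(‖x‖)` for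
almost every `x ∈ B`, for some function `h` of the radius. -/
def radial (d : ℕ) : Submodule ℂ (L2Ball d) where
  carrier := {η | ∃ h : ℝ → ℂ, Measurable h ∧ η =ᵐ[ballMeasure d] fun x => h ‖x‖}
  add_mem' := by
    rintro a b ⟨h, hm, ha⟩ ⟨k, km, hb⟩
    refine ⟨fun r => h r + k r, hm.add km, ?_⟩
    filter_upwards [Lp.coeFn_add a b, ha, hb] with x hx h1 h2
    exact hx.trans (congrArg₂ (· + ·) h1 h2)
  zero_mem' := ⟨fun _ => 0, measurable_const, Lp.coeFn_zero _ _ _⟩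
  smul_mem' := by
    rintro c a ⟨h, hm, ha⟩
    refine ⟨fun r => c * h r, hm.const_mul c, ?_⟩
    filter_upwards [Lp.coeFn_smul c a, ha] with x hx h1
    exact hx.trans (congrArg (c * ·) h1)

abbrev Radial (d : ℕ) := ↥(radial d)

/-- `η ∈ ℛ` as a function `r ↦ η(r)` of the radius (determined for almost every `r ∈ (0,1)`). -/
def profile {d : ℕ} (η : Radial d) : ℝ → ℂ := Classical.choose η.2

/-- `F : ℛ → ℒ(L²_⋄(∂B))` is a continuous linear map which agrees on bounded radial
perturbations with the Fréchet derivative at `γ = 1` of the forward map `γ ↦ Λ(γ)`. -/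
def ExtendsDerivative {d : ℕ} (F : Radial d →L[ℂ] (L2SphZero d →L[ℂ] L2SphZero d)) : Prop :=
  ∀ (η : Radial d) (ζ : LinfBall d), (η : L2Ball d) =ᵐ[ballMeasure d] ζ →
    F η = fderiv ℂ (ndMap d) (oneCond d) ζ

/-! ### Eigenvalues -/

/-- The shifted and normalized Jacobi polynomials, orthonormal on `(0,1)` with
respect to the weight `r^(d-1)`. -/
def jacobiP (d k : ℕ) (r : ℝ) : ℝ :=
  Real.sqrt (2 * k + d) * ∑ q ∈ Finset.range (k + 1),
    (-1) ^ q * (k.choose q : ℝ) * ((k + q + d - 1).choose k : ℝ) * r ^ q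

/-- `a_k(η) = ∫₀¹ η(r) P_k(r) r^(d-1) dr`. -/
def coeff {d : ℕ} (k : ℕ) (η : Radial d) : ℂ :=
  ∫ r in Set.Ioo (0 : ℝ) 1, profile η r * ((jacobiP d k r * r ^ (d - 1) : ℝ) : ℂ)

/-- `λ_ℓ(η)`, for `ℓ ≥ 1`. -/
def eigenvalue {d : ℕ} (l : ℕ) (η : Radial d) : ℂ :=
  ∑ k ∈ Finset.range (2 * l - 1), (-1) ^ (k + 1) * coeff k η *
    ((Real.sqrt (2 * k + d) / l *
      (((2 * l - 2 + d).factorial * (2 * l - 2).factorial : ℝ) /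
        ((2 * l - 2 + d + k).factorial * (2 * l - 2 - k).factorial)) : ℝ) : ℂ)

/-! ### Spherical harmonics -/

/-- The harmonic homogeneous polynomials of degree `ℓ` on `ℝ^d`, with complex coefficients. -/
def harmonicPoly (d l : ℕ) : Submodule ℂ (MvPolynomial (Fin d) ℂ) :=
  MvPolynomial.homogeneousSubmodule (Fin d) ℂ l ⊓
    LinearMap.ker (∑ i : Fin d,
      (MvPolynomial.pderiv (R := ℂ) i).toLinearMap ∘ₗ (MvPolynomial.pderiv (R := ℂ) i).toLinearMap)

/-- Restriction of a polynomial to the unit sphere, as a continuous function. -/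
def polyRestrict (d : ℕ) : MvPolynomial (Fin d) ℂ →ₗ[ℂ] C(Sph d, ℂ) where
  toFun p :=
    { toFun := fun θ => MvPolynomial.eval (fun i => (((θ : Space d) i : ℝ) : ℂ)) p
      continuous_toFun := (MvPolynomial.continuous_eval p).comp (by fun_prop) }
  map_add' p q := by ext θ; simp
  map_smul' c p := by ext θ; simp

/-- The space of spherical harmonics of degree `ℓ`, as a subspace of `L²(∂B)`. -/
def sphHarm (d l : ℕ) : Submodule ℂ (L2Sph d) :=
  (harmonicPoly d l).map
    ((ContinuousMap.toLp 2 (surfMeasure d) ℂ).toLinearMap ∘ₗ polyRestrict d)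

/-- The spherical harmonics of degree `ℓ` as a subspace of `L²_⋄(∂B)`
(all of them have mean zero when `ℓ ≥ 1`). -/
def sphHarmZero (d l : ℕ) : Submodule ℂ (L2SphZero d) :=
  (sphHarm d l).comap (meanZero d).subtype

instance (d l : ℕ) : FiniteDimensional ℂ (sphHarm d l) := by
  have h1 : FiniteDimensional ℂ (MvPolynomial.homogeneousSubmodule (Fin d) ℂ l) :=
    Module.Finite.iff_fg.2 (MvPolynomial.homogeneousSubmodule_fg _ _ l)
  have h2 : FiniteDimensional ℂ (harmonicPoly d l) :=
    Submodule.finiteDimensional_of_le inf_le_left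
  unfold sphHarm
  infer_instance

instance (d l : ℕ) : FiniteDimensional ℂ (sphHarmZero d l) := by
  let T : sphHarmZero d l →ₗ[ℂ] sphHarm d l :=
    ((meanZero d).subtype ∘ₗ (sphHarmZero d l).subtype).codRestrict (sphHarm d l) fun x => x.2
  refine FiniteDimensional.of_injective T fun x y h => ?_
  exact Subtype.ext (Subtype.ext (congrArg (fun z : sphHarm d l => (z : L2Sph d)) h))

/-- `Ψ_ℓ`: the orthogonal projection of `L²_⋄(∂B)` onto the spherical harmonics of degree `ℓ`. -/
def harmProj (d l : ℕ) : L2SphZero d →L[ℂ] L2SphZero d :=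
  (sphHarmZero d l).starProjection

end EIT

end

noncomputable section

namespace EIT

/-! ### Polar coordinates and the divergence theorem in the unit ball -/

/-! Write `T` (`traceOp`) for the map sending the gradient of a function in `H¹_⋄(B)` to its
boundary trace, and `M(γ)` (`formOp`) for multiplication by `γ` compressed to the space of
gradients. The weak formulation reads `M(γ)∇u = T*f`, so `Λ(γ) = T M(γ)⁻¹ T*` whenever `M(γ)` is
invertible. Since `M` is linear and bounded and `M(1) = 1`, `Λ` is differentiable at `1` with
`DΛ(1;ζ) = -T M(ζ) T*` (`hasFDerivAt_ndMap`). That `T` is defined and bounded rests on coercivity: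
the Poincaré and trace inequalities bound function and trace by the gradient
(`exists_norm_le_of_mem_sobolevZero`).

For a harmonic homogeneous polynomial `p` of degree `ℓ`, Euler's identity gives `∂p/∂r = ℓp` on the
sphere, so `T*` maps `p|_{∂B}` to `ℓ⁻¹∇p` (`adjoint_traceOp_harmElt`). The products `∇p · conj ∇q`
are homogeneous. Against a radial `η` the matrix element of `DΛ(1;η)` therefore splits into a moment
of `η` and a sphere integral, and the latter is known from Green's identity with `η = 1`. Hence
`DΛ(1;η)` is diagonal in the spherical harmonics, with eigenvalue `-((2ℓ-2+d)/ℓ) ∫₀¹ η r^(2ℓ-2)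
r^(d-1) dr` (`inner_fderiv_ndMap_harmElt`). Expanding `(n+d) r^n`, `n = 2ℓ-2`, in the Jacobi
polynomials (`sum_jacobiP`) turns this into `λ_ℓ(η)` (`eigenvalue_eq`).

As a functional of `η ∈ L²(B)`, `λ_ℓ` is a bounded multiple of the inner product with `‖x‖^(2ℓ-2)`,
whose norm tends to `0` (`tendsto_norm_eigenFunctional`). The `Ψ_ℓ` are mutually orthogonal
projections, so a sum `∑ c_ℓ Ψ_ℓ` has norm at most `sup |c_ℓ|` (`norm_sum_smul_harmProj_le`).
Together these make `F_N` a Cauchy sequence in operator norm, and `F` is its limit. It agrees with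
the derivative by completeness of the spherical harmonics, it is unique because bounded radial
perturbations are dense in `ℛ`, and it is compact as a norm limit of finite-rank operators. -/

/-- The partial derivative `∂_i`. -/
def pd {d : ℕ} (i : Fin d) (φ : Space d → ℂ) (x : Space d) : ℂ :=
  fderiv ℝ φ x (EuclideanSpace.single i (1 : ℝ))

lemma grad_apply {d : ℕ} (φ : Space d → ℂ) (x : Space d) (i : Fin d) :
    grad φ x i = pd i φ x := rfl

lemma finrank_space (d : ℕ) : Module.finrank ℝ (Space d) = d := by simp

lemma integral_ball_eq_polar {d : ℕ} (hd : 0 < d) {f : Space d → ℂ}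
    (hf : Integrable f (ballMeasure d)) :
    ∫ x, f x ∂(ballMeasure d) = ∫ r in Set.Ioo (0 : ℝ) 1,
      ((r ^ (d - 1) : ℝ) : ℂ) * ∫ θ : Sph d, f (r • (θ : Space d)) ∂(surfMeasure d) := by
  have : Nonempty (Fin d) := ⟨⟨0, hd⟩⟩
  have : Nontrivial (Space d) := inferInstance
  set g : Space d → ℂ := (Metric.ball (0 : Space d) 1).indicator f with hg
  have hgi : Integrable g volume := (integrable_indicator_iff measurableSet_ball).2 hf
  have mp := (volume : Measure (Space d)).measurePreserving_homeomorphUnitSphereProd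
  have emb := (homeomorphUnitSphereProd (Space d)).measurableEmbedding
  set G : Sph d × Set.Ioi (0 : ℝ) → ℂ := fun p => g ((p.2 : ℝ) • (p.1 : Space d)) with hG
  have hcomp : ∀ x : ({0}ᶜ : Set (Space d)), G (homeomorphUnitSphereProd (Space d) x) = g x := by
    intro x
    have hx : ‖(x : Space d)‖ ≠ 0 := norm_ne_zero_iff.2 x.2
    simp [hG, smul_smul, hx]
  have h1 : ∫ x, f x ∂(ballMeasure d) = ∫ x, g x := (integral_indicator measurableSet_ball).symm
  have h2 : ∫ x, g x = ∫ x : ({0}ᶜ : Set (Space d)), g x ∂(volume.comap Subtype.val) := by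
    rw [integral_subtype_comap (measurableSet_singleton _).compl fun x ↦ g x,
      restrict_compl_singleton]
  have h3 : ∫ x : ({0}ᶜ : Set (Space d)), g x ∂(volume.comap Subtype.val) =
      ∫ p, G p ∂((surfMeasure d).prod (.volumeIoiPow (d - 1))) := by
    have := mp.integral_comp emb G
    simp only [hcomp, finrank_space] at this
    exact this
  have hGi : Integrable G ((surfMeasure d).prod (.volumeIoiPow (d - 1))) := by
    have h := mp.integrable_comp_emb emb (g := G)
    rw [finrank_space] at h
    refine h.1 ?_
    have : (G ∘ homeomorphUnitSphereProd (Space d)) = fun x : ({0}ᶜ : Set (Space d)) => g x :=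
      funext hcomp
    rw [this]
    exact (integrableOn_iff_comap_subtypeVal (measurableSet_singleton _).compl).1
      hgi.integrableOn
  rw [h1, h2, h3, integral_prod_symm _ hGi, Measure.volumeIoiPow]
  simp only [ENNReal.ofReal]
  rw [integral_withDensity_eq_integral_smul (by fun_prop)]
  simp only [hG]
  rw [integral_subtype_comap measurableSet_Ioi
    fun a : ℝ ↦ Real.toNNReal (a ^ (d - 1)) • ∫ θ : Sph d, g (a • (θ : Space d)) ∂(surfMeasure d)]
  have hsub : Set.Ioo (0 : ℝ) 1 ⊆ Set.Ioi 0 := fun x hx => hx.1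
  rw [setIntegral_eq_of_subset_of_forall_sdiff_eq_zero measurableSet_Ioi hsub]
  · refine setIntegral_congr_fun measurableSet_Ioo fun r hr => ?_
    have hr0 : (0 : ℝ) ≤ r ^ (d - 1) := pow_nonneg hr.1.le _
    have : ∀ θ : Sph d, g (r • (θ : Space d)) = f (r • (θ : Space d)) := fun θ =>
      Set.indicator_of_mem (by simp [norm_smul, abs_of_pos hr.1, hr.2]) _
    simp [this, NNReal.smul_def, Real.coe_toNNReal _ hr0]
  · intro r hr
    have h1r : 1 ≤ r := by
      by_contra! h
      exact hr.2 ⟨hr.1, h⟩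
    have : ∀ θ : Sph d, g (r • (θ : Space d)) = 0 := fun θ =>
      Set.indicator_of_notMem (by simp [norm_smul, abs_of_pos (zero_lt_one.trans_le h1r), h1r]) _
    simp [this]

lemma integrable_ball_of_continuous {d : ℕ} {E : Type*} [NormedAddCommGroup E]
    {f : Space d → E} (hf : Continuous f) : Integrable f (ballMeasure d) :=
  ((hf.continuousOn.integrableOn_compact (isCompact_closedBall (0 : Space d) 1)).mono_set
    Metric.ball_subset_closedBall)

/-! ### Radial cutoffs concentrating at the boundary -/

/-- A smooth cutoff function on the line, equal to `1` for `r² ≤ 1 - 1/c` and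
to `0` for `r² ≥ 1`. -/
def radialCutoff (c r : ℝ) : ℝ := Real.smoothTransition (c * (1 - r ^ 2))

lemma deriv_smoothTransition_nonneg (s : ℝ) : 0 ≤ deriv Real.smoothTransition s :=
  Real.smoothTransition.monotone.deriv_nonneg

lemma deriv_smoothTransition_of_one_le {s : ℝ} (hs : 1 ≤ s) :
    deriv Real.smoothTransition s = 0 := by
  refine IsLocalMax.deriv_eq_zero (Eventually.of_forall fun t => ?_)
  rw [Real.smoothTransition.one_of_one_le hs]
  exact Real.smoothTransition.le_one t

lemma hasDerivAt_smoothTransition (s : ℝ) :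
    HasDerivAt Real.smoothTransition (deriv Real.smoothTransition s) s :=
  ((Real.smoothTransition.contDiff (n := 1)).differentiable (by simp) s).hasDerivAt

lemma continuous_deriv_smoothTransition : Continuous (deriv Real.smoothTransition) :=
  (Real.smoothTransition.contDiff (n := 1)).continuous_deriv le_rfl

lemma hasDerivAt_radialCutoff (c r : ℝ) :
    HasDerivAt (radialCutoff c)
      (-(2 * c * r * deriv Real.smoothTransition (c * (1 - r ^ 2)))) r := by
  have h1 : HasDerivAt (fun r : ℝ => c * (1 - r ^ 2)) (c * (-(2 * r))) r := by
    simpa using (((hasDerivAt_id r).pow 2).const_sub 1).const_mul c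
  exact ((hasDerivAt_smoothTransition (c * (1 - r ^ 2))).comp r h1).congr_deriv (by ring)

/-- The kernel is minus the derivative of `radialCutoff (n + 1)`, which falls monotonically from `1`
to `0` on `[0,1]`. It is thus nonnegative of total mass one, and it vanishes where `1 - r² ≥
1/(n+1)`: a one-sided approximate identity at `r = 1`. -/
lemma tendsto_integral_radialCutoff {Φ : ℝ → ℂ} (hΦ : Continuous Φ) :
    Tendsto (fun n : ℕ => ∫ r in Set.Ioo (0 : ℝ) 1,
      (2 * (n + 1 : ℝ) * r * deriv Real.smoothTransition ((n + 1 : ℝ) * (1 - r ^ 2))) • Φ r)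
      atTop (𝓝 (Φ 1)) := by
  have hcont : ∀ n : ℕ, Continuous fun r : ℝ =>
      2 * (n + 1 : ℝ) * r * deriv Real.smoothTransition ((n + 1 : ℝ) * (1 - r ^ 2)) := fun n => by
    have := continuous_deriv_smoothTransition
    fun_prop
  refine tendsto_setIntegral_peak_smul_of_integrableOn_of_tendsto (x₀ := (1 : ℝ))
    (t := Set.Ioo (0 : ℝ) 1) measurableSet_Ioo measurableSet_Ioo subset_rfl self_mem_nhdsWithin
    (by simp) ?_ ?_ ?_ ?_ ?_ hΦ.continuousWithinAt
  · refine Eventually.of_forall fun n r hr => ?_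
    have := deriv_smoothTransition_nonneg ((n + 1 : ℝ) * (1 - r ^ 2))
    have := hr.1
    positivity
  · intro u hu h1u
    obtain ⟨δ, hδ, hδu⟩ := Metric.isOpen_iff.1 hu 1 h1u
    rw [Metric.tendstoUniformlyOn_iff]
    intro ε hε
    obtain ⟨N, hN⟩ := exists_nat_gt (1 / δ)
    filter_upwards [eventually_ge_atTop N] with n hn r hr
    have hr1 : r ≤ 1 - δ := by
      by_contra! h
      refine hr.2 (hδu ?_)
      rw [Metric.mem_ball, Real.dist_eq, abs_lt]
      constructor <;> linarith [hr.1.2]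
    have h1 : 1 ≤ (n + 1 : ℝ) * (1 - r ^ 2) := by
      have h2 : δ ≤ 1 - r ^ 2 := by nlinarith [hr.1.1, hr.1.2]
      have h3 : 1 / δ ≤ (n + 1 : ℝ) := by
        have : (N : ℝ) ≤ n := by exact_mod_cast hn
        linarith
      calc (1 : ℝ) = 1 / δ * δ := by field_simp
        _ ≤ _ := by gcongr
    simpa [deriv_smoothTransition_of_one_le h1] using hε
  · refine (tendsto_congr fun n : ℕ => ?_).2 tendsto_const_nhds
    have h := intervalIntegral.integral_eq_sub_of_hasDerivAt (a := 0) (b := 1)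
      (fun r _ => (hasDerivAt_radialCutoff (n + 1 : ℝ) r).neg)
      (by simpa using (hcont n).intervalIntegrable 0 1)
    rw [intervalIntegral.integral_of_le zero_le_one, integral_Ioc_eq_integral_Ioo] at h
    simp only [neg_neg] at h
    rw [h]
    have : Real.smoothTransition ((n : ℝ) + 1) = 1 :=
      Real.smoothTransition.one_of_one_le (by linarith [n.cast_nonneg (α := ℝ)])
    simp [radialCutoff, this]
  · exact Eventually.of_forall fun n => (hcont n).aestronglyMeasurable
  · exact (hΦ.integrableOn_Icc (a := 0) (b := 1)).mono_set Set.Ioo_subset_Icc_self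

/-! ### Integration by parts and the divergence theorem -/

lemma continuous_pd {d : ℕ} {w : Space d → ℂ} (hw : ContDiff ℝ ∞ w) (i : Fin d) :
    Continuous (pd i w) :=
  (hw.continuous_fderiv (by simp)).clm_apply continuous_const

lemma differentiable_of_smooth {d : ℕ} {w : Space d → ℂ} (hw : ContDiff ℝ ∞ w) :
    Differentiable ℝ w := hw.differentiable (by simp)

lemma pd_mul {d : ℕ} {v w : Space d → ℂ} {x : Space d} (hv : DifferentiableAt ℝ v x)
    (hw : DifferentiableAt ℝ w x) (i : Fin d) :
    pd i (fun x => v x * w x) x = v x * pd i w x + pd i v x * w x := by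
  simp only [pd]
  rw [fderiv_fun_mul hv hw]
  simp [mul_comm]

lemma pd_star {d : ℕ} {v : Space d → ℂ} (hv : Differentiable ℝ v) (i : Fin d) (x : Space d) :
    pd i (fun x => star (v x)) x = star (pd i v x) := by
  have h : HasFDerivAt (fun x => star (v x))
      ((Complex.conjCLE : ℂ →L[ℝ] ℂ).comp (fderiv ℝ v x)) x :=
    (Complex.conjCLE : ℂ →L[ℝ] ℂ).hasFDerivAt.comp x (hv x).hasFDerivAt
  simp only [pd]
  rw [h.fderiv]
  simp

/-- Integration by parts against a compactly supported function. -/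
lemma integral_mul_pd_of_compactSupport {d : ℕ} {χ w : Space d → ℂ} (hχ : ContDiff ℝ ∞ χ)
    (hc : HasCompactSupport χ) (hw : ContDiff ℝ ∞ w) (i : Fin d) :
    ∫ x, χ x * pd i w x = - ∫ x, pd i χ x * w x := by
  have h1 : HasCompactSupport (pd i χ) := (hc.fderiv (𝕜 := ℝ)).comp_left
    (g := fun L : Space d →L[ℝ] ℂ => L (EuclideanSpace.single i (1 : ℝ))) (by simp)
  exact integral_mul_fderiv_eq_neg_fderiv_mul_of_integrable
    (((continuous_pd hχ i).mul hw.continuous).integrable_of_hasCompactSupport h1.mul_right)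
    ((hχ.continuous.mul (continuous_pd hw i)).integrable_of_hasCompactSupport hc.mul_right)
    ((hχ.continuous.mul hw.continuous).integrable_of_hasCompactSupport hc.mul_right)
    (fun x _ => differentiable_of_smooth hχ x) (fun x _ => differentiable_of_smooth hw x)

/-- The divergence theorem in the unit ball, for one component. -/
theorem integral_ball_pd {d : ℕ} (hd : 0 < d) {w : Space d → ℂ} (hw : ContDiff ℝ ∞ w)
    (i : Fin d) :
    ∫ x, pd i w x ∂(ballMeasure d) =
      ∫ θ : Sph d, (((θ : Space d) i : ℝ) : ℂ) * w θ ∂(surfMeasure d) := by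
  -- Multiply `∂_i w` by cutoffs `χ n` increasing to the indicator of the ball and integrate by
  -- parts in the whole space. In polar coordinates `-∂_i χ n` is the peak kernel times `θ_i`, so
  -- the right side tends to the boundary integral. The cutoff is smooth at the origin because it
  -- depends on `‖x‖²`.
  set χ : ℕ → Space d → ℂ := fun n x => ((radialCutoff (n + 1 : ℝ) ‖x‖ : ℝ) : ℂ) with hχdef
  have hχeq : ∀ n x, χ n x = ((Real.smoothTransition ((n + 1 : ℝ) * (1 - ‖x‖ ^ 2)) : ℝ) : ℂ) :=
    fun n x => rfl
  have hχs : ∀ n, ContDiff ℝ ∞ (χ n) := fun n => by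
    have h2 : ContDiff ℝ ∞ fun x : Space d => Real.smoothTransition ((n + 1 : ℝ) * (1 - ‖x‖ ^ 2)) :=
      Real.smoothTransition.contDiff.comp
        (contDiff_const.mul (contDiff_const.sub (contDiff_norm_sq ℝ)))
    exact Complex.ofRealCLM.contDiff.comp h2
  have hχ0 : ∀ n x, 1 ≤ ‖x‖ → χ n x = 0 := fun n x hx => by
    rw [hχeq, Real.smoothTransition.zero_of_nonpos]
    · simp
    · have : (1 : ℝ) ≤ ‖x‖ ^ 2 := one_le_pow₀ hx
      have : (0 : ℝ) ≤ n + 1 := by positivity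
      nlinarith
  have hχc : ∀ n, HasCompactSupport (χ n) := fun n =>
    HasCompactSupport.intro (isCompact_closedBall (0 : Space d) 1) fun x hx =>
      hχ0 n x (by simpa using (not_le.1 (by simpa using hx)).le)
  have hpdχ : ∀ n x, pd i (χ n) x = -((2 * (n + 1 : ℝ) *
      deriv Real.smoothTransition ((n + 1 : ℝ) * (1 - ‖x‖ ^ 2)) : ℝ) : ℂ) * ((x i : ℝ) : ℂ) := by
    intro n x
    have h1 : HasFDerivAt (fun x : Space d => (n + 1 : ℝ) * (1 - ‖x‖ ^ 2))
        ((n + 1 : ℝ) • (-((2 : ℕ) • (innerSL ℝ x : Space d →L[ℝ] ℝ)))) x :=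
      ((hasStrictFDerivAt_norm_sq x).hasFDerivAt.const_sub 1).const_mul _
    have h2 := Complex.ofRealCLM.hasFDerivAt.comp x
      ((hasDerivAt_smoothTransition ((n + 1 : ℝ) * (1 - ‖x‖ ^ 2))).comp_hasFDerivAt x h1)
    have h3 : χ n = Complex.ofRealCLM ∘
        (Real.smoothTransition ∘ fun x : Space d => (n + 1 : ℝ) * (1 - ‖x‖ ^ 2)) := rfl
    simp only [pd]
    rw [h3, h2.fderiv]
    simp [EuclideanSpace.inner_single_right]
    ring
  -- The argument of `smoothTransition` is nonpositive here, so its value `0` is a minimum; this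
  -- covers the boundary points `‖x‖ = 1` too.
  have hpd0 : ∀ n x, 1 ≤ ‖x‖ → pd i (χ n) x = 0 := fun n x hx => by
    have hx2 : (1 : ℝ) ≤ ‖x‖ ^ 2 := one_le_pow₀ hx
    have : deriv Real.smoothTransition ((n + 1 : ℝ) * (1 - ‖x‖ ^ 2)) = 0 := by
      refine IsLocalMin.deriv_eq_zero (Eventually.of_forall fun t => ?_)
      rw [Real.smoothTransition.zero_of_nonpos]
      · exact Real.smoothTransition.nonneg t
      · have : (0 : ℝ) ≤ n + 1 := by positivity
        nlinarith
    rw [hpdχ, this]; simp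
  have hball : ∀ f : Space d → ℂ, (∀ x, 1 ≤ ‖x‖ → f x = 0) →
      ∫ x, f x = ∫ x, f x ∂(ballMeasure d) := fun f hf =>
    (setIntegral_eq_integral_of_forall_compl_eq_zero fun x hx => hf x (by simpa using hx)).symm
  set Φ : ℝ → ℂ := fun r => ((r ^ (d - 1) : ℝ) : ℂ) *
    ∫ θ : Sph d, (((θ : Space d) i : ℝ) : ℂ) * w (r • (θ : Space d)) ∂(surfMeasure d) with hΦ
  have hΦc : Continuous Φ := by
    refine Continuous.mul (by fun_prop) ?_
    have hwc := hw.continuous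
    have := continuous_parametric_integral_of_continuous (μ := surfMeasure d)
      (f := fun (r : ℝ) (θ : Sph d) => (((θ : Space d) i : ℝ) : ℂ) * w (r • (θ : Space d)))
      (by fun_prop) (isCompact_univ (X := Sph d))
    simpa using this
  have key : ∀ n : ℕ, ∫ x, χ n x * pd i w x ∂(ballMeasure d) = ∫ r in Set.Ioo (0 : ℝ) 1,
      (2 * (n + 1 : ℝ) * r * deriv Real.smoothTransition ((n + 1 : ℝ) * (1 - r ^ 2))) • Φ r := by
    intro n
    rw [← hball _ fun x hx => by simp [hχ0 n x hx],
      integral_mul_pd_of_compactSupport (hχs n) (hχc n) hw i,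
      hball _ fun x hx => by simp [hpd0 n x hx],
      integral_ball_eq_polar hd (f := fun x => pd i (χ n) x * w x)
        (integrable_ball_of_continuous ((continuous_pd (hχs n) i).mul hw.continuous)),
      ← integral_neg]
    refine setIntegral_congr_fun measurableSet_Ioo fun r hr => ?_
    simp only [hpdχ, hΦ]
    have h1 : ∀ θ : Sph d, ‖r • (θ : Space d)‖ = r := fun θ => by
      simp [norm_smul, abs_of_pos hr.1]
    simp only [h1, PiLp.smul_apply, smul_eq_mul, Complex.real_smul]
    rw [← integral_const_mul, ← integral_const_mul, ← integral_neg, ← integral_const_mul]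
    refine integral_congr_ae (Eventually.of_forall fun θ => ?_)
    push_cast
    ring
  have lim1 : Tendsto (fun n : ℕ => ∫ x, χ n x * pd i w x ∂(ballMeasure d)) atTop
      (𝓝 (∫ x, pd i w x ∂(ballMeasure d))) := by
    refine tendsto_integral_of_dominated_convergence (fun x => ‖pd i w x‖)
      (fun n => ((hχs n).continuous.mul (continuous_pd hw i)).aestronglyMeasurable)
      (integrable_ball_of_continuous (continuous_pd hw i).norm) ?_ ?_
    · refine fun n => Eventually.of_forall fun x => ?_
      rw [norm_mul, hχeq, Complex.norm_real, Real.norm_eq_abs,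
        abs_of_nonneg (Real.smoothTransition.nonneg _)]
      exact mul_le_of_le_one_left (norm_nonneg _) (Real.smoothTransition.le_one _)
    · refine (ae_restrict_mem measurableSet_ball).mono fun x hx => ?_
      have hx1 : ‖x‖ < 1 := by simpa using hx
      have hx2 : 0 < 1 - ‖x‖ ^ 2 := by nlinarith [norm_nonneg x]
      refine tendsto_const_nhds.congr' ?_
      obtain ⟨N, hN⟩ := exists_nat_gt (1 / (1 - ‖x‖ ^ 2))
      filter_upwards [eventually_ge_atTop N] with n hn
      have h3 : 1 / (1 - ‖x‖ ^ 2) ≤ (n + 1 : ℝ) := by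
        have : (N : ℝ) ≤ n := by exact_mod_cast hn
        linarith
      rw [hχeq, Real.smoothTransition.one_of_one_le ((div_le_iff₀ hx2).1 h3)]
      simp
  have lim2 := tendsto_integral_radialCutoff hΦc
  simp only [← key] at lim2
  rw [tendsto_nhds_unique lim1 lim2]
  simp [hΦ]

/-! ### Poincaré and trace inequalities for smooth functions -/

lemma continuous_grad {d : ℕ} {φ : Space d → ℂ} (hφ : ContDiff ℝ ∞ φ) : Continuous (grad φ) := by
  have : ∀ i, Continuous (pd i φ) := continuous_pd hφ
  exact (PiLp.continuous_toLp 2 _).comp (continuous_pi this)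

lemma fderiv_apply_eq_sum {d : ℕ} (φ : Space d → ℂ) (x v : Space d) :
    fderiv ℝ φ x v = ∑ i, ((v i : ℝ) : ℂ) * pd i φ x := by
  have hv : v = ∑ i, (v i) • EuclideanSpace.single i (1 : ℝ) := by
    ext j
    simp [Finset.sum_apply, Pi.single_apply]
  conv_lhs => rw [hv]
  simp [pd]

lemma norm_fderiv_apply_le {d : ℕ} (φ : Space d → ℂ) (x v : Space d) :
    ‖fderiv ℝ φ x v‖ ≤ ‖v‖ * ‖grad φ x‖ := by
  rw [fderiv_apply_eq_sum, EuclideanSpace.norm_eq v, EuclideanSpace.norm_eq (grad φ x)]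
  refine (norm_sum_le _ _).trans ?_
  simp only [norm_mul, Complex.norm_real]
  exact Real.sum_mul_le_sqrt_mul_sqrt _ _ _

/-- Cauchy–Schwarz on an interval of length `1/2`, from the nonnegativity of `∫ (f - 2A)²`, where
`2A` is the mean of `f`. -/
lemma sq_integral_le_of_continuous {f : ℝ → ℝ} (hf : Continuous f) :
    2 * (∫ t in (0 : ℝ)..1 / 2, f t) ^ 2 ≤ ∫ t in (0 : ℝ)..1 / 2, f t ^ 2 := by
  set A := ∫ t in (0 : ℝ)..1 / 2, f t with hA
  have h : 0 ≤ ∫ t in (0 : ℝ)..1 / 2, (f t - 2 * A) ^ 2 :=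
    intervalIntegral.integral_nonneg (by norm_num) fun t _ => sq_nonneg _
  have h2 : ∫ t in (0 : ℝ)..1 / 2, (f t - 2 * A) ^ 2 =
      (∫ t in (0 : ℝ)..1 / 2, f t ^ 2) - 4 * A * A + 2 * A ^ 2 := by
    have : ∀ t, (f t - 2 * A) ^ 2 = f t ^ 2 - 4 * A * f t + 4 * A ^ 2 := fun t => by ring
    simp only [this]
    rw [intervalIntegral.integral_add, intervalIntegral.integral_sub,
      intervalIntegral.integral_const_mul, intervalIntegral.integral_const, ← hA]
    · simp; ring
    all_goals exact Continuous.intervalIntegrable (by fun_prop) _ _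
  nlinarith

/-- The fundamental theorem of calculus along the segment, followed only to the midpoint: for `t ≤
1/2` the map `x ↦ x + t(y - x)` contracts by a factor of at least `1/2`, so a later change of
variables in `x` stays bounded. -/
lemma norm_sub_midpoint_sq_le {d : ℕ} {φ : Space d → ℂ} (hφ : ContDiff ℝ ∞ φ) {x y : Space d}
    (hxy : ‖y - x‖ ≤ 2) :
    ‖φ x - φ (x + (1 / 2 : ℝ) • (y - x))‖ ^ 2 ≤
      2 * ∫ t in (0 : ℝ)..1 / 2, ‖grad φ (x + t • (y - x))‖ ^ 2 := by
  have hg : Continuous fun t : ℝ => ‖grad φ (x + t • (y - x))‖ := by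
    have := continuous_grad hφ
    fun_prop
  have hd : ∀ t : ℝ, HasDerivAt (fun t : ℝ => φ (x + t • (y - x)))
      (fderiv ℝ φ (x + t • (y - x)) (y - x)) t := fun t => by
    have h1 : HasDerivAt (fun t : ℝ => x + t • (y - x)) (y - x) t := by
      simpa using ((hasDerivAt_id t).smul_const (y - x)).const_add x
    exact (differentiable_of_smooth hφ _).hasFDerivAt.comp_hasDerivAt t h1
  have hc : Continuous fun t : ℝ => fderiv ℝ φ (x + t • (y - x)) (y - x) := by
    have := hφ.continuous_fderiv (by simp)
    fun_prop
  have h := intervalIntegral.integral_eq_sub_of_hasDerivAt (a := 0) (b := 1 / 2)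
    (fun t _ => hd t) (hc.intervalIntegrable _ _)
  have h1 : ‖φ x - φ (x + (1 / 2 : ℝ) • (y - x))‖ ≤
      ∫ t in (0 : ℝ)..1 / 2, 2 * ‖grad φ (x + t • (y - x))‖ := by
    rw [norm_sub_rev]
    simp only [zero_smul, add_zero] at h
    rw [← h]
    refine intervalIntegral.norm_integral_le_of_norm_le (by norm_num)
      (Eventually.of_forall fun t _ => ?_) ((by fun_prop : Continuous _).intervalIntegrable _ _)
    exact (norm_fderiv_apply_le _ _ _).trans (by gcongr)
  have h2 := sq_integral_le_of_continuous (f := fun t => 2 * ‖grad φ (x + t • (y - x))‖)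
    (by fun_prop)
  have h3 : ∫ t in (0 : ℝ)..1 / 2, (2 * ‖grad φ (x + t • (y - x))‖) ^ 2 =
      4 * ∫ t in (0 : ℝ)..1 / 2, ‖grad φ (x + t • (y - x))‖ ^ 2 := by
    rw [← intervalIntegral.integral_const_mul]
    congr 1
    ext t
    ring
  have h4 := pow_le_pow_left₀ (norm_nonneg _) h1 2
  linarith

lemma enorm_sub_midpoint_sq_le {d : ℕ} {φ : Space d → ℂ} (hφ : ContDiff ℝ ∞ φ) {x y : Space d}
    (hxy : ‖y - x‖ ≤ 2) :
    ‖φ x - φ (x + (1 / 2 : ℝ) • (y - x))‖ₑ ^ 2 ≤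
      2 * ∫⁻ t in Set.Ioc (0 : ℝ) (1 / 2), ‖grad φ (x + t • (y - x))‖ₑ ^ 2 := by
  have hg : Continuous fun t : ℝ => ‖grad φ (x + t • (y - x))‖ ^ 2 := by
    have := continuous_grad hφ
    fun_prop
  have h := norm_sub_midpoint_sq_le hφ hxy
  rw [intervalIntegral.integral_of_le (by norm_num)] at h
  have h2 := ENNReal.ofReal_le_ofReal h
  rw [ENNReal.ofReal_mul (by norm_num), ofReal_integral_eq_lintegral_ofReal
    ((hg.integrableOn_Icc).mono_set Set.Ioc_subset_Icc_self)
    (Eventually.of_forall fun t => by positivity)] at h2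
  simpa [ENNReal.ofReal_pow, ofReal_norm] using h2

/-- The map `x ↦ (1 - t)x + ty` sends the ball into itself by convexity, and its Jacobian `(1 -
t)^d` is at least `2^(-d)`. -/
lemma lintegral_ball_segment_le {d : ℕ} {g : Space d → ℝ≥0∞} (hg : Measurable g) {t : ℝ}
    (ht : t ∈ Set.Ioc (0 : ℝ) (1 / 2)) {y : Space d} (hy : y ∈ Metric.ball (0 : Space d) 1) :
    ∫⁻ x, g (x + t • (y - x)) ∂(ballMeasure d) ≤ 2 ^ d * ∫⁻ x, g x ∂(ballMeasure d) := by
  set G : Space d → ℝ≥0∞ := (Metric.ball (0 : Space d) 1).indicator g with hG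
  have hGm : Measurable G := hg.indicator measurableSet_ball
  have h1t : (0 : ℝ) < 1 - t := by linarith [ht.2]
  have step : ∫⁻ x, g (x + t • (y - x)) ∂(ballMeasure d) ≤
      ∫⁻ x, G ((1 - t) • x + t • y) := by
    rw [← lintegral_indicator measurableSet_ball]
    refine lintegral_mono fun x => ?_
    by_cases hx : x ∈ Metric.ball (0 : Space d) 1
    · have he : x + t • (y - x) = (1 - t) • x + t • y := by module
      have hm : (1 - t) • x + t • y ∈ Metric.ball (0 : Space d) 1 :=
        convex_ball (0 : Space d) 1 hx hy h1t.le ht.1.le (by ring)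
      rw [Set.indicator_of_mem hx, hG, Set.indicator_of_mem hm, he]
    · simp [Set.indicator_of_notMem hx]
  refine step.trans ?_
  have hmap := lintegral_map (μ := (volume : Measure (Space d))) (f := fun x => G (x + t • y))
    (g := fun x => (1 - t) • x) (by fun_prop) (by fun_prop)
  rw [← hmap, Measure.map_addHaar_smul _ h1t.ne', lintegral_smul_measure,
    lintegral_add_right_eq_self (μ := (volume : Measure (Space d))) G (t • y), hG,
    lintegral_indicator measurableSet_ball, smul_eq_mul]
  refine mul_le_mul_left ?_ _
  rw [abs_of_pos (by positivity), finrank_space]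
  have : ((1 - t) ^ d)⁻¹ ≤ 2 ^ d := by
    rw [← inv_pow]
    refine pow_le_pow_left₀ (by positivity) ?_ d
    rw [inv_le_comm₀ h1t (by norm_num)]
    linarith [ht.2]
  refine (ENNReal.ofReal_le_ofReal this).trans ?_
  simp [ENNReal.ofReal_pow]

lemma enorm_add_sq_le {E : Type*} [NormedAddCommGroup E] (a b : E) :
    ‖a + b‖ₑ ^ 2 ≤ 2 * ‖a‖ₑ ^ 2 + 2 * ‖b‖ₑ ^ 2 := by
  have h : ‖a + b‖ ^ 2 ≤ 2 * ‖a‖ ^ 2 + 2 * ‖b‖ ^ 2 := by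
    have := norm_add_le a b
    nlinarith [norm_nonneg (a + b), norm_nonneg a, norm_nonneg b, sq_nonneg (‖a‖ - ‖b‖)]
  have h2 := ENNReal.ofReal_le_ofReal h
  rw [ENNReal.ofReal_add (by positivity) (by positivity), ENNReal.ofReal_mul (by norm_num),
    ENNReal.ofReal_mul (by norm_num)] at h2
  simpa [ENNReal.ofReal_pow, ofReal_norm] using h2

lemma lintegral_lintegral_two_mul_add {α β : Type*} [MeasurableSpace α] [MeasurableSpace β]
    {μ : Measure α} {ν : Measure β} [SFinite ν] {f g : α → β → ℝ≥0∞}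
    (hf : Measurable (Function.uncurry f)) (hg : Measurable (Function.uncurry g)) :
    ∫⁻ y, ∫⁻ x, (2 * f y x + 2 * g y x) ∂ν ∂μ =
      2 * (∫⁻ y, ∫⁻ x, f y x ∂ν ∂μ) + 2 * ∫⁻ y, ∫⁻ x, g y x ∂ν ∂μ := by
  rw [← lintegral_const_mul _ hf.lintegral_prod_right,
    ← lintegral_const_mul _ hg.lintegral_prod_right,
    ← lintegral_add_left (hf.lintegral_prod_right.const_mul 2)]
  refine lintegral_congr fun y => ?_
  have ha : Measurable (f y) := hf.comp measurable_prodMk_left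
  have hb : Measurable (g y) := hg.comp measurable_prodMk_left
  rw [lintegral_add_left (ha.const_mul 2), lintegral_const_mul _ ha, lintegral_const_mul _ hb]

lemma ballMeasure_ne_zero (d : ℕ) : ballMeasure d ≠ 0 := by
  rw [Ne, Measure.restrict_eq_zero]
  exact (Metric.measure_ball_pos _ _ one_pos).ne'

/-- The Poincaré inequality in the unit ball. -/
theorem exists_lintegral_sub_const_le {d : ℕ} {φ : Space d → ℂ} (hφ : ContDiff ℝ ∞ φ) :
    ∃ c : ℂ, ∫⁻ x, ‖φ x - c‖ₑ ^ 2 ∂(ballMeasure d) ≤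
      4 * 2 ^ d * ∫⁻ x, ‖grad φ x‖ₑ ^ 2 ∂(ballMeasure d) := by
  set D := ∫⁻ x, ‖grad φ x‖ₑ ^ 2 ∂(ballMeasure d) with hD
  set V := ballMeasure d Set.univ with hV
  have hcφ := hφ.continuous
  have hcg := continuous_grad hφ
  -- One half of the path from `x` to `y`, integrated over all pairs. The factor `2` of the segment
  -- estimate cancels the length `1/2` of the `t`-interval.
  have hmid : ∫⁻ y, ∫⁻ x, ‖φ x - φ (x + (1 / 2 : ℝ) • (y - x))‖ₑ ^ 2 ∂(ballMeasure d)
      ∂(ballMeasure d) ≤ 2 ^ d * D * V := by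
    calc _ ≤ ∫⁻ y, ∫⁻ x,
          (2 * ∫⁻ t in Set.Ioc (0 : ℝ) (1 / 2), ‖grad φ (x + t • (y - x))‖ₑ ^ 2) ∂(ballMeasure d) ∂(ballMeasure d) := by
          refine lintegral_mono_ae ?_
          filter_upwards [ae_restrict_mem measurableSet_ball] with y hy
          refine lintegral_mono_ae ?_
          filter_upwards [ae_restrict_mem measurableSet_ball] with x hx
          refine enorm_sub_midpoint_sq_le hφ ((norm_sub_le _ _).trans ?_)
          have h1 : ‖y‖ < 1 := by simpa using hy
          have h2 : ‖x‖ < 1 := by simpa using hx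
          linarith
      _ ≤ ∫⁻ _, 2 ^ d * D ∂(ballMeasure d) := by
          refine lintegral_mono_ae ?_
          filter_upwards [ae_restrict_mem measurableSet_ball] with y hy
          have hmeas : Measurable (Function.uncurry fun (x : Space d) (t : ℝ) =>
              ‖grad φ (x + t • (y - x))‖ₑ ^ 2) :=
            Continuous.measurable (by unfold Function.uncurry; fun_prop)
          rw [lintegral_const_mul _ hmeas.lintegral_prod_right,
            lintegral_lintegral_swap hmeas.aemeasurable]
          calc _ ≤ 2 * ∫⁻ _ in Set.Ioc (0 : ℝ) (1 / 2), 2 ^ d * D := by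
                refine mul_le_mul_right (lintegral_mono_ae ?_) _
                filter_upwards [ae_restrict_mem measurableSet_Ioc] with t ht
                exact lintegral_ball_segment_le (g := fun x => ‖grad φ x‖ₑ ^ 2)
                  (Continuous.measurable (by fun_prop)) ht hy
            _ = 2 ^ d * D := by
                rw [setLIntegral_const, Real.volume_Ioc, mul_comm, mul_assoc]
                have : ENNReal.ofReal (1 / 2 - 0) * 2 = 1 := by
                  rw [← ENNReal.ofReal_ofNat 2, ← ENNReal.ofReal_mul (by norm_num)]
                  norm_num
                rw [this, mul_one]
      _ = _ := by rw [lintegral_const]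
  have hm1 : Measurable (Function.uncurry fun (y x : Space d) =>
      ‖φ x - φ (x + (1 / 2 : ℝ) • (y - x))‖ₑ ^ 2) :=
    Continuous.measurable (by unfold Function.uncurry; fun_prop)
  have hm2 : Measurable (Function.uncurry fun (y x : Space d) =>
      ‖φ y - φ (y + (1 / 2 : ℝ) • (x - y))‖ₑ ^ 2) :=
    Continuous.measurable (by unfold Function.uncurry; fun_prop)
  have hm3 : Measurable (Function.uncurry fun (y x : Space d) => ‖φ x - φ y‖ₑ ^ 2) :=
    Continuous.measurable (by unfold Function.uncurry; fun_prop)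
  have hdbl : ∫⁻ y, ∫⁻ x, ‖φ x - φ y‖ₑ ^ 2 ∂(ballMeasure d) ∂(ballMeasure d) ≤
      4 * 2 ^ d * D * V := by
    calc _ ≤ ∫⁻ y, ∫⁻ x, (2 * ‖φ x - φ (x + (1 / 2 : ℝ) • (y - x))‖ₑ ^ 2 +
            2 * ‖φ y - φ (y + (1 / 2 : ℝ) • (x - y))‖ₑ ^ 2) ∂(ballMeasure d)
            ∂(ballMeasure d) := by
          refine lintegral_mono fun y => lintegral_mono fun x => ?_
          -- Both halves end at the same midpoint, so `φ x - φ y` splits there; exchanging `x` and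
          -- `y` makes the second half an instance of `hmid`.
          have he : y + (1 / 2 : ℝ) • (x - y) = x + (1 / 2 : ℝ) • (y - x) := by module
          have h := enorm_add_sq_le (φ x - φ (x + (1 / 2 : ℝ) • (y - x)))
            (-(φ y - φ (y + (1 / 2 : ℝ) • (x - y))))
          rw [enorm_neg] at h
          refine le_trans (le_of_eq ?_) h
          rw [he]
          congr 2
          ring
      _ = 2 * (∫⁻ y, ∫⁻ x, ‖φ x - φ (x + (1 / 2 : ℝ) • (y - x))‖ₑ ^ 2 ∂(ballMeasure d)
            ∂(ballMeasure d)) + 2 * ∫⁻ y, ∫⁻ x, ‖φ y - φ (y + (1 / 2 : ℝ) • (x - y))‖ₑ ^ 2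
            ∂(ballMeasure d) ∂(ballMeasure d) := by
          exact lintegral_lintegral_two_mul_add hm1 hm2
      _ ≤ 2 * (2 ^ d * D * V) + 2 * (2 ^ d * D * V) := by
          gcongr
          rw [lintegral_lintegral_swap hm2.aemeasurable]
          exact hmid
      _ = _ := by ring
  -- The constant is a value of `φ`: at some `y` the inner integral does not exceed its average, and
  -- averaging removes the volume `V` from `hdbl`.
  obtain ⟨y, hy⟩ := exists_le_laverage (ballMeasure_ne_zero d)
    (hm3.lintegral_prod_right (ν := ballMeasure d)).aemeasurable
  refine ⟨φ y, hy.trans ?_⟩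
  rw [laverage_eq]
  exact ENNReal.div_le_of_le_mul hdbl

/-- The trace inequality in the unit ball. -/
theorem lintegral_sphere_le {d : ℕ} (hd : 0 < d) {φ : Space d → ℂ} (hφ : ContDiff ℝ ∞ φ) :
    ∫⁻ θ : Sph d, ‖φ θ‖ₑ ^ 2 ∂(surfMeasure d) ≤
      (d + 1) * ∫⁻ x, ‖φ x‖ₑ ^ 2 ∂(ballMeasure d) + ∫⁻ x, ‖grad φ x‖ₑ ^ 2 ∂(ballMeasure d) := by
  have hcφ := hφ.continuous
  have hcg := continuous_grad hφ
  have hcoord : ∀ i, ContDiff ℝ ∞ fun x : Space d => ((x i : ℝ) : ℂ) := fun i =>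
    Complex.ofRealCLM.contDiff.comp (EuclideanSpace.proj (𝕜 := ℝ) i).contDiff
  have hstar : ContDiff ℝ ∞ fun x => star (φ x) :=
    (Complex.conjCLE : ℂ →L[ℝ] ℂ).contDiff.comp hφ
  -- The divergence theorem is applied to the field `x |φ|²`. Its normal component on the sphere is
  -- `|φ|²`, and its divergence is at most `(d + 1)|φ|² + |∇φ|²` in the ball, by `2ab ≤ a² + b²` and
  -- `‖x‖ ≤ 1`.
  have hw : ∀ i, ContDiff ℝ ∞ fun x : Space d => ((x i : ℝ) : ℂ) * (φ x * star (φ x)) :=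
    fun i => (hcoord i).mul (hφ.mul hstar)
  have hpdc : ∀ i x, pd i (fun x : Space d => ((x i : ℝ) : ℂ)) x = 1 := fun i x => by
    have : HasFDerivAt (fun x : Space d => ((x i : ℝ) : ℂ))
        (Complex.ofRealCLM.comp (EuclideanSpace.proj (𝕜 := ℝ) i)) x :=
      (Complex.ofRealCLM.comp (EuclideanSpace.proj (𝕜 := ℝ) i)).hasFDerivAt
    simp [pd, this.fderiv]
  have hpd : ∀ i x, ‖pd i (fun x : Space d => ((x i : ℝ) : ℂ) * (φ x * star (φ x))) x‖ ≤
      ‖φ x‖ ^ 2 + (x i ^ 2 * ‖φ x‖ ^ 2 + ‖grad φ x i‖ ^ 2) := fun i x => by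
    rw [pd_mul (differentiable_of_smooth (hcoord i) x)
      (differentiable_of_smooth (hφ.mul hstar) x),
      pd_mul (differentiable_of_smooth hφ x) (differentiable_of_smooth hstar x),
      pd_star (differentiable_of_smooth hφ), hpdc, grad_apply]
    have h1 : ‖((x i : ℝ) : ℂ) * (φ x * star (pd i φ x) + pd i φ x * star (φ x))‖ ≤
        |x i| * (2 * (‖φ x‖ * ‖pd i φ x‖)) := by
      rw [norm_mul, Complex.norm_real, Real.norm_eq_abs]
      gcongr
      refine (norm_add_le _ _).trans (le_of_eq ?_)
      simp only [norm_mul, norm_star]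
      ring
    have h2 : ‖(1 : ℂ) * (φ x * star (φ x))‖ = ‖φ x‖ ^ 2 := by
      simp only [norm_mul, norm_star, norm_one]; ring
    refine (norm_add_le _ _).trans ?_
    rw [h2]
    have h3 := two_mul_le_add_sq (|x i| * ‖φ x‖) ‖pd i φ x‖
    rw [mul_pow, sq_abs] at h3
    linarith
  have hS : ((∫ θ : Sph d, ‖φ θ‖ ^ 2 ∂(surfMeasure d) : ℝ) : ℂ) =
      ∑ i, ∫ x, pd i (fun x : Space d => ((x i : ℝ) : ℂ) * (φ x * star (φ x))) x
        ∂(ballMeasure d) := by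
    rw [← integral_complex_ofReal]
    simp only [fun i => integral_ball_pd hd (hw i) i]
    rw [← integral_finsetSum]
    · refine integral_congr_ae (Eventually.of_forall fun θ => ?_)
      have h1 : ∑ i, ((((θ : Space d) i : ℝ) : ℂ)) ^ 2 = 1 := by
        have h := EuclideanSpace.real_norm_sq_eq (θ : Space d)
        rw [norm_eq_of_mem_sphere, one_pow] at h
        exact_mod_cast h.symm
      have h2 : φ θ * star (φ θ) = ((‖φ θ‖ ^ 2 : ℝ) : ℂ) := by
        rw [Complex.star_def, Complex.mul_conj, Complex.normSq_eq_norm_sq]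
      simp only [h2, ← mul_assoc, ← pow_two, ← Finset.sum_mul, h1, one_mul]
    · intro i _
      refine Continuous.integrable_of_hasCompactSupport ?_ (HasCompactSupport.of_compactSpace _)
      have := (hw i).continuous
      fun_prop
  have hreal : ∫ θ : Sph d, ‖φ θ‖ ^ 2 ∂(surfMeasure d) ≤
      ∫ x, ((d + 1) * ‖φ x‖ ^ 2 + ‖grad φ x‖ ^ 2) ∂(ballMeasure d) := by
    have h0 : 0 ≤ ∫ θ : Sph d, ‖φ θ‖ ^ 2 ∂(surfMeasure d) :=
      integral_nonneg fun θ => by positivity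
    rw [← abs_of_nonneg h0, ← Real.norm_eq_abs, ← Complex.norm_real, hS,
      ← integral_finsetSum _ fun i _ => integrable_ball_of_continuous (continuous_pd (hw i) i)]
    refine norm_integral_le_of_norm_le (integrable_ball_of_continuous (by fun_prop)) ?_
    filter_upwards [ae_restrict_mem measurableSet_ball] with x hx
    have hx1 : ‖x‖ < 1 := by simpa using hx
    refine (norm_sum_le _ _).trans ((Finset.sum_le_sum fun i _ => hpd i x).trans ?_)
    rw [Finset.sum_add_distrib, Finset.sum_add_distrib, ← Finset.sum_mul,
      ← EuclideanSpace.real_norm_sq_eq, ← EuclideanSpace.norm_sq_eq]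
    simp only [Finset.sum_const, Finset.card_univ, Fintype.card_fin, nsmul_eq_mul]
    have : ‖x‖ ^ 2 * ‖φ x‖ ^ 2 ≤ 1 * ‖φ x‖ ^ 2 := by
      gcongr
      exact pow_le_one₀ (norm_nonneg _) hx1.le
    linarith
  have h2 := ENNReal.ofReal_le_ofReal hreal
  rw [ofReal_integral_eq_lintegral_ofReal, ofReal_integral_eq_lintegral_ofReal] at h2
  · have e1 : ∀ z : ℂ, ENNReal.ofReal (‖z‖ ^ 2) = ‖z‖ₑ ^ 2 := fun z => by
      rw [ENNReal.ofReal_pow (norm_nonneg _), ofReal_norm]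
    have e2 : ∀ x, ENNReal.ofReal ((d + 1) * ‖φ x‖ ^ 2 + ‖grad φ x‖ ^ 2) =
        (d + 1) * ‖φ x‖ₑ ^ 2 + ‖grad φ x‖ₑ ^ 2 := fun x => by
      rw [ENNReal.ofReal_add (by positivity) (by positivity), ENNReal.ofReal_mul (by positivity),
        e1, ENNReal.ofReal_pow (norm_nonneg _), ofReal_norm]
      congr 2
      rw [ENNReal.ofReal_add (by positivity) (by positivity)]
      simp
    simp only [e1, e2] at h2
    rwa [lintegral_add_left ((Continuous.measurable (by fun_prop)).const_mul _),
      lintegral_const_mul _ (Continuous.measurable (by fun_prop))] at h2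
  · exact integrable_ball_of_continuous (by fun_prop)
  · exact Eventually.of_forall fun x => by positivity
  · exact Continuous.integrable_of_hasCompactSupport (by fun_prop)
      (HasCompactSupport.of_compactSpace _)
  · exact Eventually.of_forall fun x => by positivity

/-! ### `H¹(B)` as a closed space of triples (function, gradient, trace) -/

section Lp

variable {α β E F : Type*} {mα : MeasurableSpace α} {mβ : MeasurableSpace β}
  {μ : Measure α} {ν : Measure β} [NormedAddCommGroup E] [NormedAddCommGroup F]

lemma ofReal_norm_sq_Lp (f : Lp E 2 μ) :
    ENNReal.ofReal (‖f‖ ^ 2) = ∫⁻ x, ‖f x‖ₑ ^ 2 ∂μ := by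
  have h := eLpNorm_nnreal_pow_eq_lintegral (f := f) (μ := μ) (p := 2) (by norm_num)
  rw [ENNReal.ofReal_pow (norm_nonneg _), ofReal_norm, Lp.enorm_def]
  simpa using h

lemma norm_sq_le_of_lintegral_le {f : Lp E 2 μ} {g : Lp F 2 ν} {K : ℝ} (hK : 0 ≤ K)
    (h : ∫⁻ x, ‖f x‖ₑ ^ 2 ∂μ ≤ ENNReal.ofReal K * ∫⁻ x, ‖g x‖ₑ ^ 2 ∂ν) :
    ‖f‖ ^ 2 ≤ K * ‖g‖ ^ 2 := by
  rw [← ofReal_norm_sq_Lp, ← ofReal_norm_sq_Lp, ← ENNReal.ofReal_mul hK] at h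
  exact (ENNReal.ofReal_le_ofReal_iff (by positivity)).1 h

end Lp

lemma memLp_ball {d : ℕ} {E : Type*} [NormedAddCommGroup E]
    {f : Space d → E} (hf : Continuous f) : MemLp f 2 (ballMeasure d) := by
  obtain ⟨C, hC⟩ := (isCompact_closedBall (0 : Space d) 1).exists_bound_of_continuousOn
    hf.continuousOn
  refine MemLp.of_bound ?_ C ?_
  · have h := (integrable_ball_of_continuous hf).aestronglyMeasurable
    exact h
  · filter_upwards [ae_restrict_mem measurableSet_ball] with x hx
    exact hC x (Metric.ball_subset_closedBall hx)

lemma memLp_sphere {d : ℕ} {f : Sph d → ℂ} (hf : Continuous f) : MemLp f 2 (surfMeasure d) := by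
  obtain ⟨C, hC⟩ := isCompact_univ.exists_bound_of_continuousOn hf.continuousOn
  exact MemLp.of_bound hf.aestronglyMeasurable C (Eventually.of_forall fun x => hC x trivial)

lemma integrable_sphere {d : ℕ} {f : Sph d → ℂ} (hf : Continuous f) :
    Integrable f (surfMeasure d) :=
  hf.integrable_of_hasCompactSupport (HasCompactSupport.of_compactSpace _)

lemma grad_add {d : ℕ} {φ ψ : Space d → ℂ} (hφ : ContDiff ℝ ∞ φ) (hψ : ContDiff ℝ ∞ ψ) :
    grad (fun x => φ x + ψ x) = fun x => grad φ x + grad ψ x := by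
  ext x i
  change pd i _ x = pd i φ x + pd i ψ x
  simp only [pd]
  rw [fderiv_fun_add (differentiable_of_smooth hφ x) (differentiable_of_smooth hψ x)]
  rfl

lemma grad_const_mul {d : ℕ} (c : ℂ) {φ : Space d → ℂ} (hφ : ContDiff ℝ ∞ φ) :
    grad (fun x => c * φ x) = fun x => c • grad φ x := by
  ext x i
  change pd i _ x = c * pd i φ x
  simp only [pd]
  rw [fderiv_const_mul (differentiable_of_smooth hφ x)]
  simp

lemma grad_const {d : ℕ} (c : ℂ) : grad (fun _ : Space d => c) = fun _ => 0 := by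
  ext x i
  simp [grad]

/-- Triples of a function on `B`, a vector field on `B` and a function on `∂B`. -/
abbrev Triple (d : ℕ) : Type := L2Ball d × L2BallVec d × L2Sph d

/-- The triples `(φ, ∇φ, φ|_{∂B})` of the smooth functions `φ`. -/
def smoothTriples (d : ℕ) : Submodule ℂ (Triple d) where
  carrier := {x | ∃ φ : Space d → ℂ, ContDiff ℝ ∞ φ ∧ x.1 =ᵐ[ballMeasure d] φ ∧
    x.2.1 =ᵐ[ballMeasure d] grad φ ∧ x.2.2 =ᵐ[surfMeasure d] fun θ => φ θ}
  add_mem' := by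
    rintro a b ⟨φ, hφ, a1, a2, a3⟩ ⟨ψ, hψ, b1, b2, b3⟩
    refine ⟨fun x => φ x + ψ x, hφ.add hψ, ?_, ?_, ?_⟩
    · filter_upwards [Lp.coeFn_add a.1 b.1, a1, b1] with x h h1 h2
      rw [Prod.fst_add, h, Pi.add_apply, h1, h2]
    · rw [grad_add hφ hψ]
      filter_upwards [Lp.coeFn_add a.2.1 b.2.1, a2, b2] with x h h1 h2
      rw [Prod.snd_add, Prod.fst_add, h, Pi.add_apply, h1, h2]
    · filter_upwards [Lp.coeFn_add a.2.2 b.2.2, a3, b3] with x h h1 h2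
      rw [Prod.snd_add, Prod.snd_add, h, Pi.add_apply, h1, h2]
  zero_mem' := by
    refine ⟨fun _ => 0, contDiff_const, Lp.coeFn_zero _ _ _, ?_, Lp.coeFn_zero _ _ _⟩
    rw [grad_const]
    exact Lp.coeFn_zero _ _ _
  smul_mem' := by
    rintro c a ⟨φ, hφ, a1, a2, a3⟩
    refine ⟨fun x => c * φ x, contDiff_const.mul hφ, ?_, ?_, ?_⟩
    · filter_upwards [Lp.coeFn_smul c a.1, a1] with x h h1
      rw [Prod.smul_fst, h, Pi.smul_apply, h1, smul_eq_mul]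
    · rw [grad_const_mul c hφ]
      filter_upwards [Lp.coeFn_smul c a.2.1, a2] with x h h1
      rw [Prod.smul_snd, Prod.smul_fst, h, Pi.smul_apply, h1]
    · filter_upwards [Lp.coeFn_smul c a.2.2, a3] with x h h1
      rw [Prod.smul_snd, Prod.smul_snd, h, Pi.smul_apply, h1, smul_eq_mul]

lemma continuous_restrict_sphere {d : ℕ} {φ : Space d → ℂ} (hφ : ContDiff ℝ ∞ φ) :
    Continuous fun θ : Sph d => φ θ :=
  hφ.continuous.comp continuous_subtype_val

/-- The triple `(φ, ∇φ, φ|_{∂B})` of a smooth function `φ`. -/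
def tripleOf {d : ℕ} (φ : Space d → ℂ) (hφ : ContDiff ℝ ∞ φ) : Triple d :=
  ((memLp_ball hφ.continuous).toLp φ, (memLp_ball (continuous_grad hφ)).toLp (grad φ),
    (memLp_sphere (continuous_restrict_sphere hφ)).toLp fun θ => φ θ)

lemma tripleOf_fst {d : ℕ} {φ : Space d → ℂ} (hφ : ContDiff ℝ ∞ φ) :
    (tripleOf φ hφ).1 =ᵐ[ballMeasure d] φ := MemLp.coeFn_toLp (memLp_ball hφ.continuous)

lemma tripleOf_grad {d : ℕ} {φ : Space d → ℂ} (hφ : ContDiff ℝ ∞ φ) :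
    (tripleOf φ hφ).2.1 =ᵐ[ballMeasure d] grad φ :=
  MemLp.coeFn_toLp (memLp_ball (continuous_grad hφ))

lemma tripleOf_trace {d : ℕ} {φ : Space d → ℂ} (hφ : ContDiff ℝ ∞ φ) :
    (tripleOf φ hφ).2.2 =ᵐ[surfMeasure d] fun θ => φ θ :=
  MemLp.coeFn_toLp (memLp_sphere (continuous_restrict_sphere hφ))

lemma tripleOf_mem {d : ℕ} {φ : Space d → ℂ} (hφ : ContDiff ℝ ∞ φ) :
    tripleOf φ hφ ∈ smoothTriples d :=
  ⟨φ, hφ, tripleOf_fst hφ, tripleOf_grad hφ, tripleOf_trace hφ⟩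

lemma eq_tripleOf {d : ℕ} {x : Triple d} (hx : x ∈ smoothTriples d) :
    ∃ φ, ∃ hφ : ContDiff ℝ ∞ φ, x = tripleOf φ hφ := by
  obtain ⟨φ, hφ, h1, h2, h3⟩ := hx
  refine ⟨φ, hφ, Prod.ext ?_ (Prod.ext ?_ ?_)⟩
  · exact Lp.ext (h1.trans (tripleOf_fst hφ).symm)
  · exact Lp.ext (h2.trans (tripleOf_grad hφ).symm)
  · exact Lp.ext (h3.trans (tripleOf_trace hφ).symm)

/-- `H¹(B)`, as the closure of the smooth triples. -/
def sobolev (d : ℕ) : Submodule ℂ (Triple d) := (smoothTriples d).topologicalClosure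

/-- The three limits in `IsTrace` are one limit in the product space, and closure points in a metric
space are limits of sequences. -/
lemma isTrace_iff {d : ℕ} {u : L2Ball d} {G : L2BallVec d} {g : L2Sph d} :
    IsTrace u G g ↔ (u, G, g) ∈ sobolev d := by
  have key : ∀ (φ : ℕ → Space d → ℂ) (hφ : ∀ n, ContDiff ℝ ∞ (φ n)),
      Tendsto (fun n => tripleOf (φ n) (hφ n)) atTop (𝓝 (u, G, g)) ↔
      Tendsto (fun n => eLpNorm (fun x => φ n x - u x) 2 (ballMeasure d)) atTop (𝓝 0) ∧
      Tendsto (fun n => eLpNorm (fun x => grad (φ n) x - G x) 2 (ballMeasure d)) atTop (𝓝 0) ∧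
      Tendsto (fun n => eLpNorm (fun θ : Sph d => φ n θ - g θ) 2 (surfMeasure d)) atTop (𝓝 0) := by
    intro φ hφ
    rw [nhds_prod_eq, nhds_prod_eq, tendsto_prod_iff', tendsto_prod_iff',
      Lp.tendsto_Lp_iff_tendsto_eLpNorm', Lp.tendsto_Lp_iff_tendsto_eLpNorm',
      Lp.tendsto_Lp_iff_tendsto_eLpNorm']
    refine and_congr (tendsto_congr fun n => ?_)
      (and_congr (tendsto_congr fun n => ?_) (tendsto_congr fun n => ?_))
    · exact eLpNorm_congr_ae ((tripleOf_fst (hφ n)).sub EventuallyEq.rfl)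
    · exact eLpNorm_congr_ae ((tripleOf_grad (hφ n)).sub EventuallyEq.rfl)
    · exact eLpNorm_congr_ae ((tripleOf_trace (hφ n)).sub EventuallyEq.rfl)
  change _ ↔ (u, G, g) ∈ closure (smoothTriples d : Set (Triple d))
  rw [mem_closure_iff_seq_limit]
  constructor
  · rintro ⟨φ, hφ, h⟩
    exact ⟨fun n => tripleOf (φ n) (hφ n), fun n => tripleOf_mem _, (key φ hφ).2 h⟩
  · rintro ⟨x, hx, hlim⟩
    choose φ hφ hxφ using fun n => eq_tripleOf (hx n)
    refine ⟨φ, hφ, (key φ hφ).1 ?_⟩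
    rwa [show x = fun n => tripleOf (φ n) (hφ n) from funext hxφ] at hlim

lemma integral_mul_pd_ball {d : ℕ} {χ w : Space d → ℂ} (hχ : ContDiff ℝ ∞ χ)
    (hc : HasCompactSupport χ) (hs : tsupport χ ⊆ Metric.ball (0 : Space d) 1)
    (hw : ContDiff ℝ ∞ w) (i : Fin d) :
    ∫ x, w x * pd i χ x ∂(ballMeasure d) = - ∫ x, pd i w x * χ x ∂(ballMeasure d) := by
  have hball : ∀ f : Space d → ℂ, (∀ x, x ∉ tsupport χ → f x = 0) →
      ∫ x, f x ∂(ballMeasure d) = ∫ x, f x := fun f hf =>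
    setIntegral_eq_integral_of_forall_compl_eq_zero fun x hx => hf x fun h => hx (hs h)
  rw [hball, hball]
  · have h := integral_mul_pd_of_compactSupport hχ hc hw i
    simp only [mul_comm (pd i w _)]
    rw [h, neg_neg]
    simp only [mul_comm]
  · intro x hx
    rw [image_eq_zero_of_notMem_tsupport hx, mul_zero]
  · intro x hx
    have : fderiv ℝ χ x = 0 := by
      by_contra h
      exact hx (support_fderiv_subset ℝ h)
    simp [pd, this]

/-- Against a fixed test function both sides are inner products with fixed `L²` elements, so the
identity is a closed condition on the triple; for smooth triples it is integration by parts. Hence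
the trace condition already implies the weak-gradient condition. -/
lemma isWeakGradient_of_mem {d : ℕ} {x : Triple d} (hx : x ∈ sobolev d) :
    IsWeakGradient x.1 x.2.1 := by
  intro χ hχ hc hs i
  have hχ1 : Continuous fun x => star (pd i χ x) := (continuous_pd hχ i).star
  have hχ2 : Continuous fun x : Space d => EuclideanSpace.single i (star (χ x)) := by
    have := hχ.continuous
    have h : (fun x : Space d => EuclideanSpace.single i (star (χ x))) =
        fun x => star (χ x) • EuclideanSpace.single i (1 : ℂ) := by
      ext x j
      simp
    rw [h]
    fun_prop
  set a : L2Ball d := (memLp_ball hχ1).toLp _ with ha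
  set b : L2BallVec d := (memLp_ball hχ2).toLp _ with hb
  have ea : ∀ u : L2Ball d, inner ℂ a u = ∫ x, u x * grad χ x i ∂(ballMeasure d) := fun u => by
    rw [L2.inner_def]
    refine integral_congr_ae ?_
    filter_upwards [MemLp.coeFn_toLp (memLp_ball hχ1)] with x h
    rw [ha, h]
    simp [grad_apply]
  have eb : ∀ G : L2BallVec d, inner ℂ b G = ∫ x, G x i * χ x ∂(ballMeasure d) := fun G => by
    rw [L2.inner_def]
    refine integral_congr_ae ?_
    filter_upwards [MemLp.coeFn_toLp (memLp_ball hχ2)] with x h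
    rw [hb, h, EuclideanSpace.inner_single_left]
    simp [mul_comm]
  rw [← ea, ← eb]
  have hcl : IsClosed {y : Triple d | inner ℂ a y.1 = - inner ℂ b y.2.1} :=
    isClosed_eq (by fun_prop) (by fun_prop)
  refine closure_minimal (fun y hy => ?_) hcl hx
  obtain ⟨φ, hφ, h1, h2, -⟩ := hy
  change inner ℂ a y.1 = - inner ℂ b y.2.1
  rw [ea, eb]
  have e1 : ∫ x, y.1 x * grad χ x i ∂(ballMeasure d) = ∫ x, φ x * pd i χ x ∂(ballMeasure d) :=
    integral_congr_ae (by filter_upwards [h1] with x hx; rw [hx]; rfl)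
  have e2 : ∫ x, y.2.1 x i * χ x ∂(ballMeasure d) = ∫ x, pd i φ x * χ x ∂(ballMeasure d) :=
    integral_congr_ae (by filter_upwards [h2] with x hx; rw [hx]; rfl)
  rw [e1, e2, integral_mul_pd_ball hχ hc hs hφ i]

lemma isH1_iff {d : ℕ} {u : L2Ball d} {G : L2BallVec d} {g : L2Sph d} :
    IsH1 u G g ↔ (u, G, g) ∈ sobolev d :=
  ⟨fun h => isTrace_iff.1 h.trace, fun h => ⟨isWeakGradient_of_mem h, isTrace_iff.2 h⟩⟩

/-! ### The coercivity estimate -/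

/-- The triple of a constant function. -/
def constTriple (d : ℕ) : ℂ →L[ℂ] Triple d :=
  (Lp.constL 2 (ballMeasure d) ℂ).prod ((0 : ℂ →L[ℂ] L2BallVec d).prod
    (Lp.constL 2 (surfMeasure d) ℂ))

lemma constTriple_eq {d : ℕ} (c : ℂ) : constTriple d c = tripleOf (fun _ => c) contDiff_const := by
  refine Prod.ext ?_ (Prod.ext ?_ ?_)
  · rfl
  · refine Lp.ext ?_
    refine EventuallyEq.trans (Lp.coeFn_zero _ _ _) ?_
    refine EventuallyEq.trans ?_ (tripleOf_grad contDiff_const).symm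
    rw [grad_const]
    rfl
  · rfl

lemma surfMeasure_real_pos (d : ℕ) [NeZero d] : 0 < (surfMeasure d).real Set.univ := by
  rw [Measure.toSphere_real_apply_univ, finrank_space]
  have : 0 < (volume : Measure (Space d)).real (Metric.ball 0 1) :=
    ENNReal.toReal_pos (Metric.measure_ball_pos _ _ one_pos).ne' measure_ball_lt_top.ne
  have hd : (0 : ℝ) < d := by exact_mod_cast NeZero.pos d
  positivity

/-- The mean over `∂B` of the trace. -/
def traceMean (d : ℕ) : Triple d →L[ℂ] ℂ :=
  ((((surfMeasure d).real Set.univ)⁻¹ : ℝ) : ℂ) •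
    ((innerSL ℂ (Lp.const 2 (surfMeasure d) (1 : ℂ))) ∘L
      (ContinuousLinearMap.snd ℂ (L2BallVec d) (L2Sph d) ∘L
        ContinuousLinearMap.snd ℂ (L2Ball d) (L2BallVec d × L2Sph d)))

lemma traceMean_apply {d : ℕ} (x : Triple d) : traceMean d x =
    ((((surfMeasure d).real Set.univ)⁻¹ : ℝ) : ℂ) *
      inner ℂ (Lp.const 2 (surfMeasure d) (1 : ℂ)) x.2.2 := rfl

lemma inner_const_sphere {d : ℕ} (g : L2Sph d) :
    inner ℂ (Lp.const 2 (surfMeasure d) (1 : ℂ)) g = ∫ θ, g θ ∂(surfMeasure d) := by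
  rw [L2.inner_def]
  refine integral_congr_ae ?_
  filter_upwards [Lp.coeFn_const 2 (surfMeasure d) (1 : ℂ)] with θ h
  rw [h]; simp

lemma traceMean_const {d : ℕ} [NeZero d] (c : ℂ) : traceMean d (constTriple d c) = c := by
  rw [traceMean_apply, inner_const_sphere]
  have h1 : (constTriple d c).2.2 =ᵐ[surfMeasure d] fun _ => c :=
    Lp.coeFn_const 2 (surfMeasure d) c
  rw [integral_congr_ae h1, integral_const]
  have := (surfMeasure_real_pos d).ne'
  rw [Complex.real_smul, ← mul_assoc, ← Complex.ofReal_mul, inv_mul_cancel₀ this]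
  simp

lemma traceMean_eq_zero_iff {d : ℕ} [NeZero d] {x : Triple d} :
    traceMean d x = 0 ↔ x.2.2 ∈ meanZero d := by
  rw [traceMean_apply, meanZero, Submodule.mem_orthogonal_singleton_iff_inner_right]
  have := (surfMeasure_real_pos d).ne'
  rw [mul_eq_zero, or_iff_right (by exact_mod_cast inv_ne_zero this)]

/-- With `c` from the Poincaré inequality, `φ - c` has the gradient of `φ`, and the trace inequality
for `φ - c` controls the boundary component too. -/
lemma exists_norm_sub_const_le (d : ℕ) [NeZero d] : ∃ C : ℝ, 0 ≤ C ∧ ∀ x ∈ smoothTriples d,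
    ∃ c : ℂ, ‖x - constTriple d c‖ ≤ C * ‖x.2.1‖ := by
  set K : ℝ := 4 * 2 ^ d with hK
  set K' : ℝ := (d + 1) * K + 1 with hK'
  have hK0 : 0 ≤ K := by positivity
  -- `K` and `K'` bound squared norms; `K' + 1` dominates `1`, `√K` and `√K'`, which avoids square
  -- roots.
  refine ⟨K' + 1, by positivity, fun x hx => ?_⟩
  obtain ⟨φ, hφ, h1, h2, h3⟩ := hx
  obtain ⟨c, hc⟩ := exists_lintegral_sub_const_le hφ
  have hψ : ContDiff ℝ ∞ fun x => φ x - c := hφ.sub contDiff_const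
  have hgrad : grad (fun x => φ x - c) = grad φ := by
    ext x i
    simp [grad, fderiv_sub_const]
  have htr := lintegral_sphere_le (NeZero.pos d) hψ
  rw [hgrad] at htr
  have eG : ∫⁻ x, ‖grad φ x‖ₑ ^ 2 ∂(ballMeasure d) = ∫⁻ y, ‖x.2.1 y‖ₑ ^ 2 ∂(ballMeasure d) :=
    lintegral_congr_ae (by filter_upwards [h2] with y hy; rw [hy])
  have eK : ENNReal.ofReal K = 4 * 2 ^ d := by
    rw [hK, ENNReal.ofReal_mul (by norm_num), ENNReal.ofReal_pow (by norm_num)]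
    simp
  have eK' : ENNReal.ofReal K' = (d + 1) * ENNReal.ofReal K + 1 := by
    rw [hK', ENNReal.ofReal_add (by positivity) (by norm_num), ENNReal.ofReal_mul (by positivity),
      ENNReal.ofReal_add (by positivity) (by norm_num)]
    simp
  have b1 : ‖(x - constTriple d c).1‖ ^ 2 ≤ K * ‖x.2.1‖ ^ 2 := by
    refine norm_sq_le_of_lintegral_le hK0 ?_
    rw [← eG, eK]
    refine le_trans (le_of_eq (lintegral_congr_ae ?_)) hc
    filter_upwards [Lp.coeFn_sub x.1 (constTriple d c).1, h1,
      Lp.coeFn_const 2 (ballMeasure d) c] with y hy hy1 hy2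
    change ‖(x.1 - (constTriple d c).1 : L2Ball d) y‖ₑ ^ 2 = _
    rw [hy, Pi.sub_apply, hy1]
    change ‖φ y - Lp.const 2 (ballMeasure d) c y‖ₑ ^ 2 = _
    rw [hy2]; rfl
  have b2 : ‖(x - constTriple d c).2.2‖ ^ 2 ≤ K' * ‖x.2.1‖ ^ 2 := by
    refine norm_sq_le_of_lintegral_le (by positivity) ?_
    rw [← eG, eK', eK]
    refine le_trans (le_of_eq (lintegral_congr_ae ?_)) (htr.trans (le_trans
      (add_le_add_left (mul_le_mul_right hc _) _) (le_of_eq ?_)))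
    · filter_upwards [Lp.coeFn_sub x.2.2 (constTriple d c).2.2, h3,
        Lp.coeFn_const 2 (surfMeasure d) c] with y hy hy1 hy2
      change ‖(x.2.2 - (constTriple d c).2.2 : L2Sph d) y‖ₑ ^ 2 = _
      rw [hy, Pi.sub_apply, hy1]
      change ‖φ y - Lp.const 2 (surfMeasure d) c y‖ₑ ^ 2 = _
      rw [hy2]; rfl
    · ring
  have b3 : (x - constTriple d c).2.1 = x.2.1 := by
    change x.2.1 - 0 = x.2.1
    rw [sub_zero]
  have hKK : K ≤ K' := by
    rw [hK']
    have : (0 : ℝ) ≤ d := by positivity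
    nlinarith
  have aux : ∀ s L : ℝ, 0 ≤ s → s ≤ K' → L ^ 2 ≤ s * ‖x.2.1‖ ^ 2 → L ≤ (K' + 1) * ‖x.2.1‖ := by
    intro s L hs hsK h
    refine le_of_sq_le_sq (h.trans ?_) (by positivity)
    rw [mul_pow]
    gcongr
    nlinarith
  refine ⟨c, norm_prod_le_iff.2 ⟨aux K _ hK0 hKK b1, norm_prod_le_iff.2 ⟨?_, ?_⟩⟩⟩
  · rw [b3]
    have : (0 : ℝ) ≤ K' := by positivity
    nlinarith [norm_nonneg x.2.1]
  · exact aux K' _ (by positivity) le_rfl b2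

/-- `H¹_⋄(B)`: the elements of `H¹(B)` whose trace has mean zero. -/
def sobolevZero (d : ℕ) : Submodule ℂ (Triple d) :=
  sobolev d ⊓ (traceMean d).ker

/-- Subtracting the trace mean (the operator `P`) annihilates constants, so the unknown constant `c`
disappears and `‖P x‖ ≤ ‖P‖ C ‖∇x‖` passes to the closure; on mean-zero traces `P` is the identity.
It follows that the gradient map is injective with closed range, which makes `gradSpace` a Hilbert
space. -/
theorem exists_norm_le_of_mem_sobolevZero (d : ℕ) [NeZero d] :
    ∃ C : ℝ, 0 ≤ C ∧ ∀ x ∈ sobolevZero d, ‖x‖ ≤ C * ‖x.2.1‖ := by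
  obtain ⟨C, hC, h⟩ := exists_norm_sub_const_le d
  set P : Triple d →L[ℂ] Triple d :=
    ContinuousLinearMap.id ℂ (Triple d) - (constTriple d) ∘L (traceMean d) with hP
  have hPc : ∀ c, P (constTriple d c) = 0 := fun c => by
    simp [hP, traceMean_const]
  refine ⟨‖P‖ * C, by positivity, fun x hx => ?_⟩
  have hcl : IsClosed {x : Triple d | ‖P x‖ ≤ ‖P‖ * C * ‖x.2.1‖} :=
    isClosed_le (by fun_prop) (by fun_prop)
  have hmem : x ∈ {x : Triple d | ‖P x‖ ≤ ‖P‖ * C * ‖x.2.1‖} := by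
    refine closure_minimal (fun y hy => ?_) hcl hx.1
    obtain ⟨c, hc⟩ := h y hy
    change ‖P y‖ ≤ _
    calc ‖P y‖ = ‖P (y - constTriple d c)‖ := by rw [map_sub, hPc, sub_zero]
      _ ≤ ‖P‖ * ‖y - constTriple d c‖ := P.le_opNorm _
      _ ≤ ‖P‖ * (C * ‖y.2.1‖) := by gcongr
      _ = _ := by ring
  have hm : traceMean d x = 0 := hx.2
  have hPx : P x = x := by simp [hP, hm]
  have h' : ‖P x‖ ≤ ‖P‖ * C * ‖x.2.1‖ := hmem
  rwa [hPx] at h'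

/-! ### The Neumann-to-Dirichlet map -/

instance (d : ℕ) : CompleteSpace (sobolevZero d) :=
  IsClosed.completeSpace_coe (hs :=
    (smoothTriples d).isClosed_topologicalClosure.inter (traceMean d).isClosed_ker)

/-- The gradient on `H¹_⋄(B)`. -/
def gradMap (d : ℕ) : sobolevZero d →L[ℂ] L2BallVec d :=
  (ContinuousLinearMap.fst ℂ (L2BallVec d) (L2Sph d) ∘L
    ContinuousLinearMap.snd ℂ (L2Ball d) (L2BallVec d × L2Sph d)) ∘L (sobolevZero d).subtypeL

/-- The space of gradients of functions in `H¹(B)`. -/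
def gradSpace (d : ℕ) : Submodule ℂ (L2BallVec d) := (gradMap d).range

lemma exists_antilipschitz_gradMap (d : ℕ) [NeZero d] :
    ∃ K, AntilipschitzWith K (gradMap d) := by
  obtain ⟨C, hC, h⟩ := exists_norm_le_of_mem_sobolevZero d
  exact ⟨⟨C, hC⟩, AddMonoidHomClass.antilipschitz_of_bound (gradMap d) fun x => h x x.2⟩

lemma gradMap_injective (d : ℕ) [NeZero d] : Function.Injective (gradMap d) :=
  (exists_antilipschitz_gradMap d).choose_spec.injective

lemma isClosed_range_gradMap (d : ℕ) [NeZero d] : IsClosed (Set.range (gradMap d)) :=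
  (exists_antilipschitz_gradMap d).choose_spec.isClosed_range (gradMap d).uniformContinuous

instance (d : ℕ) [NeZero d] : CompleteSpace (gradSpace d) :=
  IsClosed.completeSpace_coe (hs := isClosed_range_gradMap d)

/-- An element of `H¹_⋄(B)` is determined by its gradient. -/
def gradEquiv (d : ℕ) [NeZero d] : sobolevZero d ≃L[ℂ] gradSpace d :=
  (gradMap d).equivRange (gradMap_injective d) (isClosed_range_gradMap d)

lemma gradEquiv_coe {d : ℕ} [NeZero d] (x : sobolevZero d) :
    (gradEquiv d x : L2BallVec d) = (x : Triple d).2.1 := rfl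

/-- The trace on `H¹_⋄(B)`. -/
def traceMap (d : ℕ) [NeZero d] : sobolevZero d →L[ℂ] L2SphZero d :=
  ((ContinuousLinearMap.snd ℂ (L2BallVec d) (L2Sph d) ∘L
    ContinuousLinearMap.snd ℂ (L2Ball d) (L2BallVec d × L2Sph d)) ∘L
      (sobolevZero d).subtypeL).codRestrict (meanZero d) fun x =>
        traceMean_eq_zero_iff.1 x.2.2

lemma traceMap_coe {d : ℕ} [NeZero d] (x : sobolevZero d) :
    (traceMap d x : L2Sph d) = (x : Triple d).2.2 := rfl

/-- The boundary potential with mean zero, as a function of the gradient. -/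
def traceOp (d : ℕ) [NeZero d] : gradSpace d →L[ℂ] L2SphZero d :=
  traceMap d ∘L ((gradEquiv d).symm : gradSpace d →L[ℂ] sobolevZero d)

lemma traceOp_gradEquiv {d : ℕ} [NeZero d] (x : sobolevZero d) :
    traceOp d (gradEquiv d x) = traceMap d x := by
  simp [traceOp]

lemma completeSpace_L2SphZero (d : ℕ) : CompleteSpace (L2SphZero d) := by
  unfold L2SphZero meanZero
  infer_instance

attribute [local instance] completeSpace_L2SphZero

/-! ### The conductivity form, weak solutions and differentiability -/

/-- Multiplication of square-integrable vector fields by bounded functions. -/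
def mulOp (d : ℕ) : LinfBall d →L[ℂ] L2BallVec d →L[ℂ] L2BallVec d :=
  (ContinuousLinearMap.lsmul ℂ ℂ :
    ℂ →L[ℂ] EuclideanSpace ℂ (Fin d) →L[ℂ] EuclideanSpace ℂ (Fin d)).holderL (ballMeasure d) ∞ 2 2

lemma inner_mulOp {d : ℕ} (γ : LinfBall d) (G G' : L2BallVec d) :
    inner ℂ G' (mulOp d γ G) = ∫ x, γ x * inner ℂ (G' x) (G x) ∂(ballMeasure d) := by
  rw [L2.inner_def]
  refine integral_congr_ae ?_
  have h : mulOp d γ G =ᵐ[ballMeasure d] fun x => γ x • G x :=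
    ContinuousLinearMap.coeFn_holder _ γ G
  filter_upwards [h] with x hx
  rw [hx, inner_smul_right]

/-- The compression of the multiplication by `γ` to the space of gradients. -/
def formOp (d : ℕ) [NeZero d] : LinfBall d →L[ℂ] gradSpace d →L[ℂ] gradSpace d :=
  ((ContinuousLinearMap.compL ℂ (gradSpace d) (L2BallVec d) (gradSpace d)
      (gradSpace d).orthogonalProjectionOnto) ∘L
    ((ContinuousLinearMap.compL ℂ (gradSpace d) (L2BallVec d) (L2BallVec d)).flip
      (gradSpace d).subtypeL)) ∘L mulOp d

lemma inner_formOp {d : ℕ} [NeZero d] (γ : LinfBall d) (G G' : gradSpace d) :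
    inner ℂ G' (formOp d γ G) =
      ∫ x, γ x * inner ℂ ((G' : L2BallVec d) x) ((G : L2BallVec d) x) ∂(ballMeasure d) := by
  rw [← inner_mulOp]
  exact (gradSpace d).inner_orthogonalProjectionOnto_eq_of_mem_left G' (mulOp d γ G)

lemma formOp_one {d : ℕ} [NeZero d] : formOp d (oneCond d) = 1 := by
  ext1 G
  refine ext_inner_left ℂ fun G' => ?_
  rw [inner_formOp, one_apply_eq_self, Submodule.coe_inner, L2.inner_def]
  refine integral_congr_ae ?_
  filter_upwards [Lp.coeFn_const ∞ (ballMeasure d) (1 : ℂ)] with x hx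
  rw [oneCond, hx]
  simp

lemma constTriple_mem_sobolev {d : ℕ} (c : ℂ) : constTriple d c ∈ sobolev d :=
  (smoothTriples d).le_topologicalClosure (constTriple_eq c ▸ tripleOf_mem _)

lemma sub_constTriple_mem_sobolevZero {d : ℕ} [NeZero d] {x : Triple d} (hx : x ∈ sobolev d) :
    x - constTriple d (traceMean d x) ∈ sobolevZero d := by
  refine ⟨(sobolev d).sub_mem hx (constTriple_mem_sobolev _), ?_⟩
  change traceMean d (x - constTriple d (traceMean d x)) = 0
  rw [map_sub, traceMean_const, sub_self]

lemma inner_const_trace {d : ℕ} (c : ℂ) (f : L2SphZero d) :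
    inner ℂ (constTriple d c).2.2 (f : L2Sph d) = 0 := by
  have h : (constTriple d c).2.2 = c • Lp.const 2 (surfMeasure d) (1 : ℂ) := by
    change Lp.const 2 (surfMeasure d) c = _
    refine Lp.ext ?_
    filter_upwards [Lp.coeFn_const 2 (surfMeasure d) c,
      Lp.coeFn_smul c (Lp.const 2 (surfMeasure d) (1 : ℂ)),
      Lp.coeFn_const 2 (surfMeasure d) (1 : ℂ)] with θ h1 h2 h3
    rw [h1, h2, Pi.smul_apply, h3]
    simp
  rw [h, inner_smul_left, (Submodule.mem_orthogonal_singleton_iff_inner_right).1 f.2, mul_zero]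

/-- Test functions may be normalised to mean-zero trace, since constants have zero gradient and `f`
is orthogonal to them. Both sides of the weak form are then inner products in `gradSpace` against an
arbitrary gradient. -/
lemma isWeakSolution_iff {d : ℕ} [NeZero d] {γ : LinfBall d} {f g : L2SphZero d}
    {u : L2Ball d} {G : L2BallVec d} :
    IsWeakSolution γ f u G g ↔ ∃ x : sobolevZero d, (x : Triple d) = (u, G, (g : L2Sph d)) ∧
      formOp d γ (gradEquiv d x) = (traceOp d).adjoint f := by
  have hform : ∀ x y : sobolevZero d,
      inner ℂ (gradEquiv d y) (formOp d γ (gradEquiv d x)) = ∫ z, γ z * inner ℂ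
        ((y : Triple d).2.1 z) ((x : Triple d).2.1 z) ∂(ballMeasure d) := fun x y =>
    inner_formOp γ (gradEquiv d x) (gradEquiv d y)
  have hadj : ∀ y : sobolevZero d, inner ℂ (gradEquiv d y) ((traceOp d).adjoint f) =
      inner ℂ (y : Triple d).2.2 (f : L2Sph d) := fun y => by
    rw [ContinuousLinearMap.adjoint_inner_right, traceOp_gradEquiv, Submodule.coe_inner,
      traceMap_coe]
  constructor
  · rintro ⟨h1, h2⟩
    refine ⟨⟨(u, G, (g : L2Sph d)), isH1_iff.1 h1, traceMean_eq_zero_iff.2 g.2⟩, rfl, ?_⟩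
    refine ext_inner_left ℂ fun z => ?_
    obtain ⟨y, rfl⟩ := (gradEquiv d).surjective z
    rw [hform, hadj, L2.inner_def]
    exact h2 _ _ _ (isH1_iff.2 y.2.1)
  · rintro ⟨x, hx, h⟩
    refine ⟨isH1_iff.2 (hx ▸ x.2.1), fun v Gv gv hv => ?_⟩
    have hv' := isH1_iff.1 hv
    set c := traceMean d (v, Gv, gv) with hc
    set y : sobolevZero d := ⟨_, sub_constTriple_mem_sobolevZero hv'⟩ with hy
    have hy1 : (y : Triple d).2.1 = Gv := by
      change Gv - 0 = Gv
      rw [sub_zero]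
    have hy2 : gv = (y : Triple d).2.2 + (constTriple d c).2.2 := by
      change gv = gv - _ + _
      rw [sub_add_cancel]
    have h2 := (hform x y).symm.trans ((congrArg _ h).trans (hadj y))
    rw [hy1, hx] at h2
    rw [h2, ← L2.inner_def, hy2, inner_add_left, inner_const_trace, add_zero]

/-- The Neumann-to-Dirichlet map in terms of the compression of the conductivity. -/
def ndForm (d : ℕ) [NeZero d] (γ : LinfBall d) : L2SphZero d →L[ℂ] L2SphZero d :=
  traceOp d ∘L (Ring.inverse (formOp d γ)) ∘L (traceOp d).adjoint

lemma isNDMap_ndForm {d : ℕ} [NeZero d] {γ : LinfBall d} (hγ : IsUnit (formOp d γ)) :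
    IsNDMap γ (ndForm d γ) := by
  have inv1 : ∀ z, Ring.inverse (formOp d γ) (formOp d γ z) = z := fun z =>
    congrArg (fun A : gradSpace d →L[ℂ] gradSpace d => A z) (Ring.inverse_mul_cancel _ hγ)
  have inv2 : ∀ z, formOp d γ (Ring.inverse (formOp d γ) z) = z := fun z =>
    congrArg (fun A : gradSpace d →L[ℂ] gradSpace d => A z) (Ring.mul_inverse_cancel _ hγ)
  intro f g
  constructor
  · rintro ⟨u, G, h⟩
    obtain ⟨x, hx, h⟩ := isWeakSolution_iff.1 h
    have : ndForm d γ f = traceOp d (Ring.inverse (formOp d γ) ((traceOp d).adjoint f)) := rfl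
    rw [this, ← h, inv1, traceOp_gradEquiv]
    refine Subtype.ext ?_
    rw [traceMap_coe, hx]
  · rintro rfl
    obtain ⟨x, hx⟩ := (gradEquiv d).surjective
      (Ring.inverse (formOp d γ) ((traceOp d).adjoint f))
    have hg : ndForm d γ f = traceMap d x := by
      rw [← traceOp_gradEquiv, hx]
      rfl
    refine ⟨(x : Triple d).1, (x : Triple d).2.1, isWeakSolution_iff.2 ⟨x, ?_, ?_⟩⟩
    · rw [hg, traceMap_coe]
    · rw [hx, inv2]

lemma IsNDMap.unique {d : ℕ} {γ : LinfBall d} {A A' : L2SphZero d →L[ℂ] L2SphZero d}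
    (h : IsNDMap γ A) (h' : IsNDMap γ A') : A = A' :=
  ContinuousLinearMap.ext fun f => (h' f (A f)).1 ((h f (A f)).2 rfl)

lemma ndMap_eq_ndForm {d : ℕ} [NeZero d] {γ : LinfBall d} (hγ : IsUnit (formOp d γ)) :
    ndMap d γ = ndForm d γ := by
  have h : ∃ A, IsNDMap γ A := ⟨_, isNDMap_ndForm hγ⟩
  rw [ndMap, dif_pos h]
  exact h.choose_spec.unique (isNDMap_ndForm hγ)

/-- The bounded linear map `A ↦ T A T*`. -/
def sandwich (d : ℕ) [NeZero d] :
    (gradSpace d →L[ℂ] gradSpace d) →L[ℂ] L2SphZero d →L[ℂ] L2SphZero d :=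
  (ContinuousLinearMap.compL ℂ (L2SphZero d) (gradSpace d) (L2SphZero d) (traceOp d)) ∘L
    ((ContinuousLinearMap.compL ℂ (L2SphZero d) (gradSpace d) (gradSpace d)).flip
      (traceOp d).adjoint)

/-- `ndForm` is operator inversion between the linear maps `formOp` and `sandwich`, and inversion
has derivative `-id` at the identity. Invertibility is an open condition, so `ndMap` and `ndForm`
coincide near `γ = 1`. -/
theorem hasFDerivAt_ndMap (d : ℕ) [NeZero d] :
    HasFDerivAt (ndMap d) (-(sandwich d ∘L formOp d)) (oneCond d) := by
  have h1 : HasFDerivAt (Ring.inverse : (gradSpace d →L[ℂ] gradSpace d) → _)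
      (-(1 : (gradSpace d →L[ℂ] gradSpace d) →L[ℂ] _)) (formOp d (oneCond d)) := by
    have h := hasFDerivAt_ringInverse (𝕜 := ℂ) (1 : (gradSpace d →L[ℂ] gradSpace d)ˣ)
    rw [formOp_one]
    refine h.congr_fderiv ?_
    ext1 A
    simp
  have h2 := (sandwich d).hasFDerivAt.comp (oneCond d)
    (h1.comp (oneCond d) (formOp d).hasFDerivAt)
  have h3 : HasFDerivAt (ndForm d) (-(sandwich d ∘L formOp d)) (oneCond d) := by
    refine h2.congr_fderiv ?_
    ext1 ζ
    simp
  refine h3.congr_of_eventuallyEq ?_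
  have hopen : {A : gradSpace d →L[ℂ] gradSpace d | IsUnit A} ∈ 𝓝 (formOp d (oneCond d)) :=
    Units.isOpen.mem_nhds (by rw [formOp_one]; exact isUnit_one)
  filter_upwards [(formOp d).continuous.continuousAt hopen] with γ hγ
  exact ndMap_eq_ndForm hγ

/-- Since `formOp` is the identity at `γ = 1`, `(traceOp d).adjoint f` is the gradient of the
solution with datum `f` for unit conductivity; this is the classical formula `-∫ ζ ∇u_f · conj
∇u_g`. -/
lemma inner_fderiv_ndMap {d : ℕ} [NeZero d] (ζ : LinfBall d) (f g : L2SphZero d) :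
    inner ℂ g (fderiv ℂ (ndMap d) (oneCond d) ζ f) = - ∫ x, ζ x * inner ℂ
      (((traceOp d).adjoint g : L2BallVec d) x) (((traceOp d).adjoint f : L2BallVec d) x)
        ∂(ballMeasure d) := by
  rw [(hasFDerivAt_ndMap d).fderiv, ← inner_formOp]
  change inner ℂ g (-(traceOp d (formOp d ζ ((traceOp d).adjoint f)))) = _
  rw [inner_neg_right, ContinuousLinearMap.adjoint_inner_left]

/-! ### Polynomials and spherical harmonics -/

open MvPolynomial in
/-- A complex polynomial as a function on `ℝ^d`. -/
def polyFun {d : ℕ} (p : MvPolynomial (Fin d) ℂ) (x : Space d) : ℂ :=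
  eval (fun i => ((x i : ℝ) : ℂ)) p

section Polynomials

open MvPolynomial

variable {d : ℕ}

lemma contDiff_polyFun (p : MvPolynomial (Fin d) ℂ) : ContDiff ℝ ∞ (polyFun p) := by
  induction p using MvPolynomial.induction_on with
  | C a =>
    have : polyFun (C a : MvPolynomial (Fin d) ℂ) = fun _ => a := by ext x; simp [polyFun]
    rw [this]
    exact contDiff_const
  | add p q hp hq =>
    have : polyFun (p + q) = fun x => polyFun p x + polyFun q x := by ext x; simp [polyFun]
    rw [this]
    exact hp.add hq
  | mul_X p i hp =>
    have : polyFun (p * X i) = fun x => polyFun p x * ((x i : ℝ) : ℂ) := by ext x; simp [polyFun]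
    rw [this]
    exact hp.mul (Complex.ofRealCLM.contDiff.comp (EuclideanSpace.proj (𝕜 := ℝ) i).contDiff)

lemma pd_coord (i j : Fin d) (x : Space d) :
    pd i (fun x : Space d => ((x j : ℝ) : ℂ)) x = if j = i then 1 else 0 := by
  have : HasFDerivAt (fun x : Space d => ((x j : ℝ) : ℂ))
      (Complex.ofRealCLM.comp (EuclideanSpace.proj (𝕜 := ℝ) j)) x :=
    (Complex.ofRealCLM.comp (EuclideanSpace.proj (𝕜 := ℝ) j)).hasFDerivAt
  simp only [pd, this.fderiv]
  by_cases h : j = i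
  · simp [h]
  · simp [h]

lemma pd_polyFun (i : Fin d) (p : MvPolynomial (Fin d) ℂ) :
    pd i (polyFun p) = polyFun (pderiv i p) := by
  induction p using MvPolynomial.induction_on with
  | C a =>
    have : polyFun (C a : MvPolynomial (Fin d) ℂ) = fun _ => a := by ext x; simp [polyFun]
    ext x
    rw [this]
    simp [pd, polyFun]
  | add p q hp hq =>
    have : polyFun (p + q) = fun x => polyFun p x + polyFun q x := by ext x; simp [polyFun]
    ext x
    have h : pd i (polyFun (p + q)) x = pd i (polyFun p) x + pd i (polyFun q) x := by
      rw [this]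
      simp only [pd]
      rw [fderiv_fun_add (differentiable_of_smooth (contDiff_polyFun p) x)
        (differentiable_of_smooth (contDiff_polyFun q) x)]
      rfl
    rw [h, hp, hq]
    simp [polyFun]
  | mul_X p j hp =>
    have hX : ContDiff ℝ ∞ fun x : Space d => ((x j : ℝ) : ℂ) :=
      Complex.ofRealCLM.contDiff.comp (EuclideanSpace.proj (𝕜 := ℝ) j).contDiff
    have : polyFun (p * X j) = fun x => polyFun p x * ((x j : ℝ) : ℂ) := by ext x; simp [polyFun]
    ext x
    rw [this, pd_mul (differentiable_of_smooth (contDiff_polyFun p) x)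
      (differentiable_of_smooth hX x), hp, pd_coord]
    by_cases h : j = i
    · subst h
      simp [polyFun]
      ring
    · simp [polyFun, h]
      ring

lemma polyFun_smul {p : MvPolynomial (Fin d) ℂ} {n : ℕ} (hp : p.IsHomogeneous n) (r : ℝ)
    (x : Space d) : polyFun p (r • x) = (r : ℂ) ^ n * polyFun p x := by
  simp only [polyFun, eval_eq', Finset.mul_sum]
  refine Finset.sum_congr rfl fun s hs => ?_
  have hn : ∑ i, s i = n := by
    rw [← hp (mem_support_iff.1 hs), Finsupp.weight_apply, Finsupp.sum_fintype _ _ (by simp)]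
    simp
  have : ∏ i, (((r • x) i : ℝ) : ℂ) ^ s i = (r : ℂ) ^ n * ∏ i, ((x i : ℝ) : ℂ) ^ s i := by
    rw [← hn, ← Finset.prod_pow_eq_pow_sum, ← Finset.prod_mul_distrib]
    refine Finset.prod_congr rfl fun i _ => ?_
    simp [mul_pow]
  rw [this]
  ring

lemma sum_coord_mul_pderiv {p : MvPolynomial (Fin d) ℂ} {n : ℕ} (hp : p.IsHomogeneous n)
    (x : Space d) :
    ∑ i, ((x i : ℝ) : ℂ) * polyFun (pderiv i p) x = n * polyFun p x := by
  have h := congrArg (fun q => polyFun q x) hp.sum_X_mul_pderiv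
  simpa [polyFun] using h

lemma mem_harmonicPoly {l : ℕ} {p : MvPolynomial (Fin d) ℂ} :
    p ∈ harmonicPoly d l ↔ p.IsHomogeneous l ∧ ∑ i, pderiv i (pderiv i p) = 0 := by
  rw [harmonicPoly, Submodule.mem_inf, mem_homogeneousSubmodule, LinearMap.mem_ker,
    LinearMap.sum_apply]
  rfl

/-- A polynomial as an element of `L²(∂B)`. -/
def sphPoly (d : ℕ) : MvPolynomial (Fin d) ℂ →ₗ[ℂ] L2Sph d :=
  (ContinuousMap.toLp 2 (surfMeasure d) ℂ).toLinearMap ∘ₗ polyRestrict d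

lemma sphPoly_coeFn (p : MvPolynomial (Fin d) ℂ) :
    sphPoly d p =ᵐ[surfMeasure d] fun θ => polyFun p θ :=
  ContinuousMap.coeFn_toLp (𝕜 := ℂ) (surfMeasure d) (polyRestrict d p)

lemma mem_sphHarm {l : ℕ} {g : L2Sph d} :
    g ∈ sphHarm d l ↔ ∃ p ∈ harmonicPoly d l, sphPoly d p = g := Iff.rfl

lemma inner_sphPoly (p q : MvPolynomial (Fin d) ℂ) : inner ℂ (sphPoly d q) (sphPoly d p) =
    ∫ θ : Sph d, inner ℂ (polyFun q θ) (polyFun p θ) ∂(surfMeasure d) := by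
  rw [L2.inner_def]
  refine integral_congr_ae ?_
  filter_upwards [sphPoly_coeFn p, sphPoly_coeFn q] with θ h1 h2
  rw [h1, h2]

/-- Green's identity for a homogeneous harmonic polynomial and a smooth function. -/
theorem integral_inner_grad_polyFun [NeZero d] {l : ℕ} {p : MvPolynomial (Fin d) ℂ}
    (hp : p ∈ harmonicPoly d l) {v : Space d → ℂ} (hv : ContDiff ℝ ∞ v) :
    ∫ x, inner ℂ (grad v x) (grad (polyFun p) x) ∂(ballMeasure d) =
      l * ∫ θ : Sph d, inner ℂ (v θ) (polyFun p θ) ∂(surfMeasure d) := by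
  obtain ⟨hhom, hharm⟩ := mem_harmonicPoly.1 hp
  have hstar : ContDiff ℝ ∞ fun x => star (v x) :=
    (Complex.conjCLE : ℂ →L[ℝ] ℂ).contDiff.comp hv
  -- The divergence theorem for the field `conj(v) ∇p`: harmonicity leaves `∇p · conj ∇v` as its
  -- divergence, and Euler's identity gives the normal component `l p conj(v)`.
  have hw : ∀ i, ContDiff ℝ ∞ fun x => polyFun (pderiv i p) x * star (v x) := fun i =>
    (contDiff_polyFun _).mul hstar
  have h1 : ∀ x, inner ℂ (grad v x) (grad (polyFun p) x) =
      ∑ i, pd i (fun x => polyFun (pderiv i p) x * star (v x)) x := fun x => by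
    have e1 : ∀ i, pd i (fun x => polyFun (pderiv i p) x * star (v x)) x =
        polyFun (pderiv i p) x * star (pd i v x) + polyFun (pderiv i (pderiv i p)) x * star (v x) :=
      fun i => by
        rw [pd_mul (differentiable_of_smooth (contDiff_polyFun _) x)
          (differentiable_of_smooth hstar x), pd_star (differentiable_of_smooth hv), pd_polyFun]
    have e2 : ∑ i, polyFun (pderiv i (pderiv i p)) x = 0 := by
      have h := congrArg (fun q => polyFun q x) hharm
      simpa [polyFun] using h
    simp only [e1]
    rw [Finset.sum_add_distrib, ← Finset.sum_mul, e2, zero_mul, add_zero, PiLp.inner_apply]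
    refine Finset.sum_congr rfl fun i _ => ?_
    rw [grad_apply, grad_apply, pd_polyFun]
    simp
  simp only [h1]
  rw [integral_finsetSum _ fun i _ => integrable_ball_of_continuous (continuous_pd (hw i) i)]
  simp only [fun i => integral_ball_pd (NeZero.pos d) (hw i) i]
  rw [← integral_finsetSum, ← integral_const_mul]
  · refine integral_congr_ae (Eventually.of_forall fun θ => ?_)
    have h := sum_coord_mul_pderiv hhom (θ : Space d)
    simp only [← mul_assoc, ← Finset.sum_mul, h]
    simp
    ring
  · intro i _
    exact integrable_sphere (Continuous.mul (by fun_prop)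
      ((hw i).continuous.comp continuous_subtype_val))

lemma inner_grad_polyFun (p q : MvPolynomial (Fin d) ℂ) (x : Space d) :
    inner ℂ (grad (polyFun q) x) (grad (polyFun p) x) =
      ∑ i, polyFun (pderiv i p) x * star (polyFun (pderiv i q) x) := by
  rw [PiLp.inner_apply]
  refine Finset.sum_congr rfl fun i _ => ?_
  rw [grad_apply, grad_apply, pd_polyFun, pd_polyFun]
  simp

/-- Spherical harmonics of different degrees are orthogonal. -/
theorem inner_sphPoly_of_ne [NeZero d] {l m : ℕ} (hlm : l ≠ m) {p q : MvPolynomial (Fin d) ℂ}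
    (hp : p ∈ harmonicPoly d l) (hq : q ∈ harmonicPoly d m) :
    inner ℂ (sphPoly d q) (sphPoly d p) = 0 := by
  have h1 := integral_inner_grad_polyFun hp (contDiff_polyFun q)
  have h2 := integral_inner_grad_polyFun hq (contDiff_polyFun p)
  rw [← inner_sphPoly] at h1 h2
  -- Hermitian symmetry of the Dirichlet form, combined with Green's identity on either side, yields
  -- `(l - m)⟨q, p⟩ = 0`.
  have h3 : ∫ x, inner ℂ (grad (polyFun q) x) (grad (polyFun p) x) ∂(ballMeasure d) =
      star (∫ x, inner ℂ (grad (polyFun p) x) (grad (polyFun q) x) ∂(ballMeasure d)) := by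
    rw [Complex.star_def, ← integral_conj]
    simp only [inner_conj_symm]
  rw [h1, h2] at h3
  have h4 : star ((m : ℂ) * inner ℂ (sphPoly d p) (sphPoly d q)) =
      m * inner ℂ (sphPoly d q) (sphPoly d p) := by
    rw [Complex.star_def, map_mul, inner_conj_symm]
    simp
  rw [h4, ← sub_eq_zero, ← sub_mul, mul_eq_zero, sub_eq_zero] at h3
  exact h3.resolve_left (by exact_mod_cast hlm)

/-- A continuous function that is zero in `L²(∂B)` vanishes on the whole sphere, and homogeneity
spreads this to `ℝ^d ∖ {0}`. -/
lemma sphPoly_injOn [NeZero d] {n : ℕ} {p : MvPolynomial (Fin d) ℂ} (hp : p.IsHomogeneous n)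
    (h : sphPoly d p = 0) : p = 0 := by
  have : Nontrivial (Space d) := by
    have : Nonempty (Fin d) := ⟨⟨0, NeZero.pos d⟩⟩
    infer_instance
  have h0 : polyRestrict d p = 0 :=
    ContinuousMap.toLp_injective (𝕜 := ℂ) (p := 2) (surfMeasure d) (by simpa [sphPoly] using h)
  have hS : ∀ θ : Sph d, polyFun p θ = 0 := fun θ => congrArg (fun f : C(Sph d, ℂ) => f θ) h0
  have hx : ∀ x : Space d, x ≠ 0 → polyFun p x = 0 := fun x hx => by
    have hx' : ‖x‖ ≠ 0 := norm_ne_zero_iff.2 hx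
    have e : x = ‖x‖ • (‖x‖⁻¹ • x) := by rw [smul_smul, mul_inv_cancel₀ hx', one_smul]
    rw [e, polyFun_smul hp, hS ⟨‖x‖⁻¹ • x, by simp [norm_smul, hx']⟩, mul_zero]
  -- A polynomial vanishing on a product of infinite sets is zero; positive coordinates keep the
  -- points away from the origin.
  refine MvPolynomial.funext_set (fun _ => (fun r : ℝ => (r : ℂ)) '' Set.Ioi 0)
    (fun _ => (Set.Ioi_infinite (0 : ℝ)).image Complex.ofReal_injective.injOn) fun y hy => ?_
  choose r hr hry using fun i => hy i trivial
  have he : y = fun i => (((WithLp.toLp 2 r : Space d) i : ℝ) : ℂ) := funext fun i => (hry i).symm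
  rw [map_zero, he]
  refine hx _ fun h => ?_
  have h1 : r ⟨0, NeZero.pos d⟩ = 0 := congrArg (fun x : Space d => x ⟨0, NeZero.pos d⟩) h
  exact (hr ⟨0, NeZero.pos d⟩ : (0 : ℝ) < _).ne' h1

/-! ### Reduction of polynomials on the sphere to harmonic ones -/

/-- The polynomial `∑ x_i²`. -/
def normSqPoly (d : ℕ) : MvPolynomial (Fin d) ℂ := ∑ i, X i ^ 2

lemma isHomogeneous_normSqPoly : (normSqPoly d).IsHomogeneous 2 :=
  IsHomogeneous.sum _ _ _ fun i _ => isHomogeneous_X_pow i 2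

lemma sphPoly_normSqPoly_mul (q : MvPolynomial (Fin d) ℂ) :
    sphPoly d (normSqPoly d * q) = sphPoly d q := by
  have : polyRestrict d (normSqPoly d * q) = polyRestrict d q := by
    ext θ
    have h : ∑ i, ((((θ : Space d) i : ℝ) : ℂ)) ^ 2 = 1 := by
      have h := EuclideanSpace.real_norm_sq_eq (θ : Space d)
      rw [norm_eq_of_mem_sphere, one_pow] at h
      exact_mod_cast h.symm
    simp [polyRestrict, normSqPoly, h]
  simp [sphPoly, this]

lemma isHomogeneous_laplacian {n : ℕ} {q : MvPolynomial (Fin d) ℂ} (hq : q.IsHomogeneous (n + 2)) :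
    (∑ i, pderiv i (pderiv i q)).IsHomogeneous n :=
  IsHomogeneous.sum _ _ _ fun _ _ => hq.pderiv.pderiv

/-- The span of the spherical harmonics of degree at most `n`. -/
def sphHarmLE (d n : ℕ) : Submodule ℂ (L2Sph d) := ⨆ l : Fin (n + 1), sphHarm d l

lemma sphHarm_le_sphHarmLE {l n : ℕ} (h : l ≤ n) : sphHarm d l ≤ sphHarmLE d n :=
  le_iSup (fun l : Fin (n + 1) => sphHarm d l) ⟨l, Nat.lt_succ_of_le h⟩

lemma sphHarmLE_mono {m n : ℕ} (h : m ≤ n) : sphHarmLE d m ≤ sphHarmLE d n :=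
  iSup_le fun l => sphHarm_le_sphHarmLE ((Nat.le_of_lt_succ l.2).trans h)

lemma inner_eq_zero_of_mem_sphHarmLE [NeZero d] {m n : ℕ} (hmn : m < n) {g : L2Sph d}
    (hg : g ∈ sphHarmLE d m) {p : MvPolynomial (Fin d) ℂ} (hp : p ∈ harmonicPoly d n) :
    inner ℂ (sphPoly d p) g = 0 := by
  have h : sphHarmLE d m ≤ (ℂ ∙ sphPoly d p)ᗮ := iSup_le fun l f hf => by
    obtain ⟨q, hq, rfl⟩ := mem_sphHarm.1 hf
    rw [Submodule.mem_orthogonal_singleton_iff_inner_right]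
    exact inner_sphPoly_of_ne (by have := l.2; omega) hq hp
  exact Submodule.mem_orthogonal_singleton_iff_inner_right.1 (h hg)

/-- On the sphere, every homogeneous polynomial is a sum of spherical harmonics. -/
theorem sphPoly_mem_sphHarmLE [NeZero d] (n : ℕ) {q : MvPolynomial (Fin d) ℂ}
    (hq : q.IsHomogeneous n) : sphPoly d q ∈ sphHarmLE d n := by
  induction n using Nat.strong_induction_on generalizing q with
  | _ n ih =>
  rcases lt_or_ge n 2 with hn | hn
  · refine sphHarm_le_sphHarmLE le_rfl (mem_sphHarm.2 ⟨q, mem_harmonicPoly.2 ⟨hq, ?_⟩, rfl⟩)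
    refine Finset.sum_eq_zero fun i _ => ?_
    have h : (pderiv i q).IsHomogeneous 0 := by
      have h := hq.pderiv (i := i)
      rwa [show n - 1 = 0 by omega] at h
    rw [totalDegree_eq_zero_iff_eq_C.1 (Nat.le_zero.1 h.totalDegree_le), pderiv_C]
  · obtain ⟨m, rfl⟩ := Nat.exists_eq_add_of_le' hn
    set W := homogeneousSubmodule (Fin d) ℂ m with hW
    have : FiniteDimensional ℂ W :=
      Module.Finite.iff_fg.2 (MvPolynomial.homogeneousSubmodule_fg _ _ m)
    have hmul : ∀ r : W, (normSqPoly d * (r : MvPolynomial (Fin d) ℂ)).IsHomogeneous (m + 2) :=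
      fun r => by
        rw [add_comm]
        exact isHomogeneous_normSqPoly.mul ((mem_homogeneousSubmodule m _).1 r.2)
    -- `L r = Δ(|x|² r)`. Once `L` is onto, some `r` has `Δ(|x|² r) = Δq`, so `q` is the harmonic
    -- polynomial `q - |x|² r` plus `|x|² r`, and the latter equals `r` on the sphere.
    let L : W →ₗ[ℂ] W :=
      { toFun := fun r => ⟨∑ i, pderiv i (pderiv i (normSqPoly d * (r : MvPolynomial (Fin d) ℂ))),
          (mem_homogeneousSubmodule m _).2 (isHomogeneous_laplacian (hmul r))⟩
        map_add' := fun r s => by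
          ext1
          simp [mul_add, Finset.sum_add_distrib]
        map_smul' := fun c r => by
          ext1
          simp only [Submodule.coe_smul, mul_smul_comm, RingHom.id_apply, Finset.smul_sum,
            Derivation.map_smul] }
    -- If `|x|² r` is harmonic, it is a harmonic of degree `m + 2` which on the sphere equals `r`,
    -- by induction a sum of harmonics of degree at most `m`. It is thus orthogonal to itself.
    have hinj : Function.Injective L := by
      rw [← LinearMap.ker_eq_bot, LinearMap.ker_eq_bot']
      intro r hr
      have hr' : normSqPoly d * (r : MvPolynomial (Fin d) ℂ) ∈ harmonicPoly d (m + 2) :=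
        mem_harmonicPoly.2 ⟨hmul r, congrArg Subtype.val hr⟩
      have hrm : (r : MvPolynomial (Fin d) ℂ).IsHomogeneous m :=
        (mem_homogeneousSubmodule m _).1 r.2
      have h0 := inner_eq_zero_of_mem_sphHarmLE (by omega) (ih m (by omega) hrm) hr'
      rw [sphPoly_normSqPoly_mul, inner_self_eq_zero] at h0
      exact Subtype.ext (sphPoly_injOn hrm h0)
    obtain ⟨r, hr⟩ := LinearMap.surjective_of_injective hinj
      ⟨∑ i, pderiv i (pderiv i q), (mem_homogeneousSubmodule m _).2 (isHomogeneous_laplacian hq)⟩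
    have hr' : ∑ i, pderiv i (pderiv i (normSqPoly d * (r : MvPolynomial (Fin d) ℂ))) =
        ∑ i, pderiv i (pderiv i q) := congrArg Subtype.val hr
    have hrm : (r : MvPolynomial (Fin d) ℂ).IsHomogeneous m :=
      (mem_homogeneousSubmodule m _).1 r.2
    have hharm : q - normSqPoly d * (r : MvPolynomial (Fin d) ℂ) ∈ harmonicPoly d (m + 2) := by
      refine mem_harmonicPoly.2 ⟨hq.sub (hmul r), ?_⟩
      simp only [map_sub, Finset.sum_sub_distrib, hr', sub_self]
    have e : sphPoly d q = sphPoly d (q - normSqPoly d * (r : MvPolynomial (Fin d) ℂ)) +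
        sphPoly d (r : MvPolynomial (Fin d) ℂ) := by
      rw [map_sub, sphPoly_normSqPoly_mul, sub_add_cancel]
    rw [e]
    exact Submodule.add_mem _ (sphHarm_le_sphHarmLE le_rfl (mem_sphHarm.2 ⟨_, hharm, rfl⟩))
      (sphHarmLE_mono (by omega) (ih m (by omega) hrm))

/-! ### Completeness of the spherical harmonics -/

lemma polyRestrict_apply (p : MvPolynomial (Fin d) ℂ) (θ : Sph d) :
    polyRestrict d p θ = polyFun p θ := rfl

/-- The restrictions of polynomials to the sphere, as a star subalgebra. -/
def polyStarSubalgebra (d : ℕ) : StarSubalgebra ℂ C(Sph d, ℂ) where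
  carrier := Set.range (polyRestrict d)
  mul_mem' := by
    rintro _ _ ⟨p, rfl⟩ ⟨q, rfl⟩
    exact ⟨p * q, by ext θ; simp [polyRestrict_apply, polyFun]⟩
  add_mem' := by
    rintro _ _ ⟨p, rfl⟩ ⟨q, rfl⟩
    exact ⟨p + q, map_add _ _ _⟩
  algebraMap_mem' c := ⟨C c, by ext θ; simp [polyRestrict_apply, polyFun]⟩
  star_mem' := by
    rintro _ ⟨p, rfl⟩
    refine ⟨MvPolynomial.map (starRingEnd ℂ) p, ?_⟩
    ext θ
    rw [ContinuousMap.star_apply, polyRestrict_apply, polyRestrict_apply]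
    have h : (fun i => (starRingEnd ℂ) ((((θ : Space d) i : ℝ) : ℂ))) =
        fun i => (((θ : Space d) i : ℝ) : ℂ) := funext fun i => Complex.conj_ofReal _
    have h2 := MvPolynomial.eval₂_comp_left (starRingEnd ℂ) (RingHom.id ℂ)
      (fun i => (((θ : Space d) i : ℝ) : ℂ)) p
    simp only [polyFun, eval_map]
    rw [Complex.star_def]
    change _ = (starRingEnd ℂ) (eval₂ (RingHom.id ℂ) _ p)
    rw [h2]
    simp only [Function.comp_def, h, RingHom.comp_id]

/-- Stone–Weierstrass, with the coordinates separating points, followed by the density of continuous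
functions in `L²`. -/
lemma denseRange_sphPoly [NeZero d] : DenseRange (sphPoly d) := by
  have hsep : (polyStarSubalgebra d).SeparatesPoints := by
    intro θ θ' hne
    obtain ⟨i, hi⟩ : ∃ i, (θ : Space d) i ≠ (θ' : Space d) i := by
      by_contra! h
      exact hne (Subtype.ext (PiLp.ext h))
    refine ⟨polyRestrict d (X i), ⟨polyRestrict d (X i), ⟨X i, rfl⟩, rfl⟩, ?_⟩
    simpa [polyRestrict_apply, polyFun] using hi
  have htop := ContinuousMap.starSubalgebra_topologicalClosure_eq_top_of_separatesPoints
    (polyStarSubalgebra d) hsep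
  have hdense : DenseRange (polyRestrict d) := by
    intro f
    have : f ∈ (polyStarSubalgebra d).topologicalClosure := htop ▸ trivial
    exact this
  exact (ContinuousMap.toLp_denseRange ℂ (surfMeasure d) ℂ (by norm_num)).comp hdense
    (ContinuousMap.toLp 2 (surfMeasure d) ℂ).continuous

/-- The spherical harmonics are complete in `L²(∂B)`. -/
theorem eq_zero_of_inner_sphPoly [NeZero d] {g : L2Sph d}
    (h : ∀ l, ∀ p ∈ harmonicPoly d l, inner ℂ g (sphPoly d p) = 0) : g = 0 := by
  refine denseRange_sphPoly.eq_zero_of_inner_left ℂ fun q => ?_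
  rw [← sum_homogeneousComponent q, map_sum, inner_sum]
  refine Finset.sum_eq_zero fun n _ => ?_
  have hle : sphHarmLE d n ≤ (ℂ ∙ g)ᗮ := iSup_le fun l f hf => by
    obtain ⟨p, hp, rfl⟩ := mem_sphHarm.1 hf
    rw [Submodule.mem_orthogonal_singleton_iff_inner_right]
    exact h l p hp
  exact Submodule.mem_orthogonal_singleton_iff_inner_right.1
    (hle (sphPoly_mem_sphHarmLE n (homogeneousComponent_isHomogeneous n q)))

end Polynomials

/-! ### The derivative on radial perturbations -/

section Radial

open MvPolynomial

variable {d : ℕ}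

/-- Green's identity with `v = 1` gives `0 = l ∫ p`. -/
lemma sphPoly_mem_meanZero [NeZero d] {l : ℕ} (hl : 1 ≤ l) {p : MvPolynomial (Fin d) ℂ}
    (hp : p ∈ harmonicPoly d l) : sphPoly d p ∈ meanZero d := by
  rw [meanZero, Submodule.mem_orthogonal_singleton_iff_inner_right, inner_const_sphere,
    integral_congr_ae (sphPoly_coeFn p)]
  have h := integral_inner_grad_polyFun hp (v := fun _ => 1) contDiff_const
  rw [grad_const] at h
  have hl' : (l : ℂ) ≠ 0 := by exact_mod_cast (by omega : l ≠ 0)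
  simpa [hl'] using h

/-- A spherical harmonic of positive degree as an element of `L²_⋄(∂B)`. -/
def harmElt [NeZero d] {l : ℕ} (hl : 1 ≤ l) {p : MvPolynomial (Fin d) ℂ}
    (hp : p ∈ harmonicPoly d l) : L2SphZero d := ⟨sphPoly d p, sphPoly_mem_meanZero hl hp⟩

lemma tripleOf_polyFun_trace (p : MvPolynomial (Fin d) ℂ) :
    (tripleOf (polyFun p) (contDiff_polyFun p)).2.2 = sphPoly d p :=
  Lp.ext ((tripleOf_trace _).trans (sphPoly_coeFn p).symm)

lemma tripleOf_polyFun_mem [NeZero d] {l : ℕ} (hl : 1 ≤ l) {p : MvPolynomial (Fin d) ℂ}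
    (hp : p ∈ harmonicPoly d l) :
    tripleOf (polyFun p) (contDiff_polyFun p) ∈ sobolevZero d := by
  refine ⟨(smoothTriples d).le_topologicalClosure (tripleOf_mem _), ?_⟩
  exact traceMean_eq_zero_iff.2 (tripleOf_polyFun_trace p ▸ sphPoly_mem_meanZero hl hp)

lemma inner_grad_triple [NeZero d] {l : ℕ} {p : MvPolynomial (Fin d) ℂ}
    (hp : p ∈ harmonicPoly d l) {y : Triple d} (hy : y ∈ sobolev d) :
    inner ℂ y.2.1 (tripleOf (polyFun p) (contDiff_polyFun p)).2.1 =
      l * inner ℂ y.2.2 (sphPoly d p) := by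
  have hcl : IsClosed {y : Triple d | inner ℂ y.2.1
      (tripleOf (polyFun p) (contDiff_polyFun p)).2.1 = l * inner ℂ y.2.2 (sphPoly d p)} :=
    isClosed_eq (by fun_prop) (by fun_prop)
  refine closure_minimal (fun y hy => ?_) hcl hy
  obtain ⟨φ, hφ, -, h2, h3⟩ := hy
  change inner ℂ y.2.1 (tripleOf (polyFun p) (contDiff_polyFun p)).2.1 =
    l * inner ℂ y.2.2 (sphPoly d p)
  have e1 : inner ℂ y.2.1 (tripleOf (polyFun p) (contDiff_polyFun p)).2.1 =
      ∫ x, inner ℂ (grad φ x) (grad (polyFun p) x) ∂(ballMeasure d) := by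
    rw [L2.inner_def]
    refine integral_congr_ae ?_
    filter_upwards [h2, tripleOf_grad (contDiff_polyFun p)] with x hx1 hx2
    rw [hx1, hx2]
  have e2 : inner ℂ y.2.2 (sphPoly d p) =
      ∫ θ : Sph d, inner ℂ (φ θ) (polyFun p θ) ∂(surfMeasure d) := by
    rw [L2.inner_def]
    refine integral_congr_ae ?_
    filter_upwards [h3, sphPoly_coeFn p] with x hx1 hx2
    rw [hx1, hx2]
  rw [e1, e2, integral_inner_grad_polyFun hp hφ]

/-- `p / l` is the harmonic function with Neumann datum `p` on the sphere; Green's identity,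
extended to `H¹(B)`, is its weak formulation. -/
lemma adjoint_traceOp_harmElt [NeZero d] {l : ℕ} (hl : 1 ≤ l) {p : MvPolynomial (Fin d) ℂ}
    (hp : p ∈ harmonicPoly d l) :
    ((traceOp d).adjoint (harmElt hl hp) : L2BallVec d) =ᵐ[ballMeasure d]
      fun x => (l : ℂ)⁻¹ • grad (polyFun p) x := by
  set t : sobolevZero d := ⟨_, tripleOf_polyFun_mem hl hp⟩ with ht
  have hl' : (l : ℂ) ≠ 0 := by exact_mod_cast (by omega : l ≠ 0)
  have h : (traceOp d).adjoint (harmElt hl hp) = (l : ℂ)⁻¹ • gradEquiv d t := by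
    refine ext_inner_left ℂ fun z => ?_
    obtain ⟨y, rfl⟩ := (gradEquiv d).surjective z
    rw [ContinuousLinearMap.adjoint_inner_right, traceOp_gradEquiv, inner_smul_right,
      Submodule.coe_inner, Submodule.coe_inner, traceMap_coe, gradEquiv_coe, gradEquiv_coe, ht,
      inner_grad_triple hp y.2.1, ← mul_assoc, inv_mul_cancel₀ hl', one_mul]
    rfl
  rw [h, Submodule.coe_smul]
  refine (Lp.coeFn_smul _ _).trans ?_
  filter_upwards [tripleOf_grad (contDiff_polyFun p)] with x hx
  rw [Pi.smul_apply, gradEquiv_coe]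
  exact congrArg _ hx

lemma inner_grad_polyFun_smul {l m : ℕ} {p q : MvPolynomial (Fin d) ℂ}
    (hp : p.IsHomogeneous l) (hq : q.IsHomogeneous m) (r : ℝ) (x : Space d) :
    inner ℂ (grad (polyFun q) (r • x)) (grad (polyFun p) (r • x)) =
      (r : ℂ) ^ ((l - 1) + (m - 1)) * inner ℂ (grad (polyFun q) x) (grad (polyFun p) x) := by
  rw [inner_grad_polyFun, inner_grad_polyFun, Finset.mul_sum]
  refine Finset.sum_congr rfl fun i _ => ?_
  rw [polyFun_smul hp.pderiv, polyFun_smul hq.pderiv, star_mul', pow_add]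
  simp only [star_pow, Complex.star_def, Complex.conj_ofReal]
  ring

lemma continuous_inner_grad_polyFun (p q : MvPolynomial (Fin d) ℂ) :
    Continuous fun x => inner ℂ (grad (polyFun q) x) (grad (polyFun p) x) := by
  have h1 := continuous_grad (contDiff_polyFun p)
  have h2 := continuous_grad (contDiff_polyFun q)
  fun_prop

lemma integral_radial_mul_of_homogeneous [NeZero d] {h : ℝ → ℂ} {K : Space d → ℂ}
    (hK : Continuous K) {n : ℕ} (hhom : ∀ (r : ℝ) x, K (r • x) = (r : ℂ) ^ n * K x)
    (hh : Integrable (fun x => h ‖x‖) (ballMeasure d)) :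
    ∫ x, h ‖x‖ * K x ∂(ballMeasure d) =
      (∫ r in Set.Ioo (0 : ℝ) 1, h r * ((r ^ n * r ^ (d - 1) : ℝ) : ℂ)) *
        ∫ θ : Sph d, K θ ∂(surfMeasure d) := by
  obtain ⟨C, hC⟩ := (isCompact_closedBall (0 : Space d) 1).exists_bound_of_continuousOn
    hK.continuousOn
  rw [integral_ball_eq_polar (NeZero.pos d) (hh.mul_bdd hK.aestronglyMeasurable
    ((ae_restrict_mem measurableSet_ball).mono fun x hx =>
      hC x (Metric.ball_subset_closedBall hx))), ← integral_mul_const]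
  refine setIntegral_congr_fun measurableSet_Ioo fun r hr => ?_
  have h1 : ∀ θ : Sph d, ‖r • (θ : Space d)‖ = r := fun θ => by
    simp [norm_smul, abs_of_pos hr.1]
  simp only [h1, hhom]
  rw [integral_const_mul, integral_const_mul]
  push_cast
  ring

lemma integral_pow_Ioo (n : ℕ) [NeZero d] :
    ∫ r in Set.Ioo (0 : ℝ) 1, (1 : ℂ) * ((r ^ n * r ^ (d - 1) : ℝ) : ℂ) = ((n + d : ℝ)⁻¹ : ℝ) := by
  have hd := NeZero.pos d
  simp only [one_mul]
  rw [integral_complex_ofReal, ← integral_Ioc_eq_integral_Ioo,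
    ← intervalIntegral.integral_of_le zero_le_one]
  simp only [← pow_add]
  rw [integral_pow]
  have : ((n + (d - 1) : ℕ) : ℝ) + 1 = n + d := by
    rw [← Nat.cast_succ, ← Nat.cast_add]
    congr 1
    omega
  rw [this]
  simp

/-- The moment of a radial profile that determines the `l`-th eigenvalue. -/
def radialMoment (d n : ℕ) (h : ℝ → ℂ) : ℂ :=
  ∫ r in Set.Ioo (0 : ℝ) 1, h r * ((r ^ n * r ^ (d - 1) : ℝ) : ℂ)

/-- The sphere integral of `∇p · conj ∇q` is not computed directly. For `h = 1` the same
factorisation has radial factor `1/((l-1)+(m-1)+d)`, and Green's identity evaluates the product as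
`l⟨q, p⟩`. -/
lemma integral_radial_inner_grad [NeZero d] {h : ℝ → ℂ}
    (hh : Integrable (fun x => h ‖x‖) (ballMeasure d)) {l m : ℕ}
    {p q : MvPolynomial (Fin d) ℂ} (hp : p ∈ harmonicPoly d l) (hq : q ∈ harmonicPoly d m) :
    ∫ x, h ‖x‖ * inner ℂ (grad (polyFun q) x) (grad (polyFun p) x) ∂(ballMeasure d) =
      radialMoment d ((l - 1) + (m - 1)) h *
        (((l - 1 : ℕ) + (m - 1 : ℕ) + d) * (l * inner ℂ (sphPoly d q) (sphPoly d p))) := by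
  have hhom := inner_grad_polyFun_smul (mem_harmonicPoly.1 hp).1 (mem_harmonicPoly.1 hq).1
  have hc := continuous_inner_grad_polyFun p q
  rw [integral_radial_mul_of_homogeneous hc hhom hh, radialMoment]
  congr 1
  have h1 := integral_radial_mul_of_homogeneous (h := fun _ => 1) hc hhom (integrable_const _)
  rw [integral_pow_Ioo] at h1
  simp only [one_mul] at h1
  rw [integral_inner_grad_polyFun hp (contDiff_polyFun q), ← inner_sphPoly] at h1
  have hd : (0 : ℝ) < d := by exact_mod_cast NeZero.pos d
  have h2 : (((l - 1 : ℕ) : ℂ) + ((m - 1 : ℕ) : ℂ) + d) *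
      ((((((l - 1) + (m - 1) : ℕ) : ℝ) + d)⁻¹ : ℝ) : ℂ) = 1 := by
    have h3 : ((((l - 1) + (m - 1) : ℕ) : ℝ) + d) ≠ 0 := by positivity
    have h4 : (((l - 1 : ℕ) : ℂ) + ((m - 1 : ℕ) : ℂ) + d) =
      (((((l - 1) + (m - 1) : ℕ) : ℝ) + d : ℝ) : ℂ) := by push_cast; ring
    rw [h4, ← Complex.ofReal_mul, mul_inv_cancel₀ h3, Complex.ofReal_one]
  rw [h1, ← mul_assoc, h2, one_mul]

/-- The matrix elements of the derivative of the forward map with respect to spherical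
harmonics. -/
theorem inner_fderiv_ndMap_harmElt [NeZero d] {ζ : LinfBall d} {h : ℝ → ℂ}
    (hζ : ζ =ᵐ[ballMeasure d] fun x => h ‖x‖)
    {l m : ℕ} (hl : 1 ≤ l) (hm : 1 ≤ m) {p q : MvPolynomial (Fin d) ℂ}
    (hp : p ∈ harmonicPoly d l) (hq : q ∈ harmonicPoly d m) :
    inner ℂ (harmElt hm hq) (fderiv ℂ (ndMap d) (oneCond d) ζ (harmElt hl hp)) =
      -(((2 * l - 2 : ℕ) + d : ℂ) / l * radialMoment d (2 * l - 2) h) *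
        inner ℂ (harmElt hm hq) (harmElt hl hp) := by
  have hint : Integrable (fun x => h ‖x‖) (ballMeasure d) :=
    ((Lp.memLp ζ).integrable le_top).congr hζ
  have hl' : (l : ℂ) ≠ 0 := by exact_mod_cast (by omega : l ≠ 0)
  have hm' : (m : ℂ) ≠ 0 := by exact_mod_cast (by omega : m ≠ 0)
  rw [inner_fderiv_ndMap]
  have e : ∫ x, ζ x * inner ℂ (((traceOp d).adjoint (harmElt hm hq) : L2BallVec d) x)
      (((traceOp d).adjoint (harmElt hl hp) : L2BallVec d) x) ∂(ballMeasure d) =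
      (m : ℂ)⁻¹ * (l : ℂ)⁻¹ * ∫ x, h ‖x‖ * inner ℂ (grad (polyFun q) x) (grad (polyFun p) x)
        ∂(ballMeasure d) := by
    rw [← integral_const_mul]
    refine integral_congr_ae ?_
    filter_upwards [hζ, adjoint_traceOp_harmElt hl hp, adjoint_traceOp_harmElt hm hq]
      with x h1 h2 h3
    rw [h1, h2, h3, inner_smul_left, inner_smul_right]
    simp
    ring
  rw [e, integral_radial_inner_grad hint hp hq]
  change _ = _ * inner ℂ (sphPoly d q) (sphPoly d p)
  by_cases hlm : l = m
  · subst hlm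
    rw [show (l - 1) + (l - 1) = 2 * l - 2 by omega, ← Nat.cast_add,
      show (l - 1) + (l - 1) = 2 * l - 2 by omega]
    field_simp
  · rw [inner_sphPoly_of_ne hlm hp hq]
    simp

/-! ### The eigenvalues -/

/-- `N` times the `j`-th term is the difference of the right-hand sides at `j + 1` and `j`. The
closed form stops at `m = N`, since `N - m` is truncated beyond that. -/
lemma sum_range_telescope (a N m : ℕ) (hm : m ≤ N) :
    (N : ℝ) * ∑ j ∈ Finset.range m, (-1) ^ j * (2 * j + a + 1 : ℝ) * (a + j).factorial /
      ((a + 1 + N + j).factorial * (N - j).factorial * j.factorial) =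
    (-1) ^ (m + 1) * m * (a + m).factorial /
      (m.factorial * (a + N + m).factorial * (N - m).factorial) := by
  induction m with
  | zero => simp
  | succ m ih =>
    obtain ⟨s, rfl⟩ := Nat.exists_eq_add_of_lt (Nat.lt_of_succ_le hm)
    rw [Finset.sum_range_succ, mul_add, ih (by omega)]
    rw [show m + s + 1 - m = s + 1 by omega, show m + s + 1 - (m + 1) = s by omega,
      show a + 1 + (m + s + 1) + m = (a + (m + s + 1) + m) + 1 by omega,
      show a + (m + s + 1) + (m + 1) = (a + (m + s + 1) + m) + 1 by omega,
      show a + (m + 1) = (a + m) + 1 by omega]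
    simp only [Nat.factorial_succ]
    have h1 := Nat.factorial_ne_zero (a + (m + s + 1) + m)
    have h2 := Nat.factorial_ne_zero s
    have h3 := Nat.factorial_ne_zero m
    generalize (a + (m + s + 1) + m).factorial = A at *
    generalize s.factorial = S at *
    generalize m.factorial = F at *
    have h1' : (A : ℝ) ≠ 0 := by exact_mod_cast h1
    have h2' : (S : ℝ) ≠ 0 := by exact_mod_cast h2
    have h3' : (F : ℝ) ≠ 0 := by exact_mod_cast h3
    push_cast
    field_simp
    ring

/-- For `N > 0` the telescoped sum over `j < N` cancels the last term `j = N`. This is the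
cancellation behind the Jacobi expansion of a power. -/
lemma sum_alternating_factorial (a N : ℕ) :
    ∑ j ∈ Finset.range (N + 1), (-1) ^ j * (2 * j + a + 1 : ℝ) * (a + j).factorial /
      ((a + 1 + N + j).factorial * (N - j).factorial * j.factorial) = if N = 0 then 1 else 0 := by
  split_ifs with hN
  · subst hN
    have h := Nat.factorial_ne_zero a
    have h' : (a.factorial : ℝ) ≠ 0 := by exact_mod_cast h
    have h1 : (a : ℝ) + 1 ≠ 0 := by positivity
    simp [Nat.factorial_succ, h1, h]
  · have hN' : (N : ℝ) ≠ 0 := by exact_mod_cast hN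
    refine (mul_eq_zero.1 ?_).resolve_left hN'
    rw [Finset.sum_range_succ, mul_add, sum_range_telescope a N N le_rfl,
      show a + 1 + N + N = (a + N + N) + 1 by omega]
    simp only [Nat.factorial_succ, Nat.sub_self, Nat.factorial_zero]
    have h1 : ((a + N + N).factorial : ℝ) ≠ 0 := by exact_mod_cast Nat.factorial_ne_zero _
    have h2 : (N.factorial : ℝ) ≠ 0 := by exact_mod_cast Nat.factorial_ne_zero _
    push_cast
    field_simp
    ring

lemma choose_mul_choose_eq {q j e : ℕ} :
    ((q + j).choose q : ℝ) * ((q + j + q + e).choose (q + j) : ℝ) =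
      (2 * q + e + j).factorial / (q.factorial * j.factorial * (q + e).factorial) := by
  rw [Nat.cast_choose ℝ (by omega : q ≤ q + j), Nat.cast_choose ℝ (by omega : q + j ≤ q + j + q + e),
    show q + j - q = j by omega, show q + j + q + e - (q + j) = q + e by omega,
    show q + j + q + e = 2 * q + e + j by omega]
  have h1 : ((q + j).factorial : ℝ) ≠ 0 := by exact_mod_cast Nat.factorial_ne_zero _
  field_simp

/-- The expansion of a power in the Jacobi polynomials. -/
theorem sum_jacobiP [NeZero d] (n : ℕ) (r : ℝ) :
    ∑ k ∈ Finset.range (n + 1), (-1) ^ k * (Real.sqrt (2 * k + d) *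
      (((n + d).factorial * n.factorial : ℝ) / ((n + d + k).factorial * (n - k).factorial))) *
        jacobiP d k r = (n + d) * r ^ n := by
  obtain ⟨e, rfl⟩ : ∃ e, d = e + 1 := ⟨d - 1, by have := NeZero.pos d; omega⟩
  set f : ℕ → ℕ → ℝ := fun k q => (-1) ^ k * ((2 * k + (e + 1 : ℕ)) *
      (((n + (e + 1)).factorial * n.factorial : ℝ) /
        ((n + (e + 1) + k).factorial * (n - k).factorial))) *
      ((-1) ^ q * (k.choose q : ℝ) * ((k + q + (e + 1) - 1).choose k : ℝ) * r ^ q) with hf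
  have h1 : ∀ k : ℕ, (-1) ^ k * (Real.sqrt (2 * k + (e + 1 : ℕ)) *
      (((n + (e + 1)).factorial * n.factorial : ℝ) /
        ((n + (e + 1) + k).factorial * (n - k).factorial))) *
        jacobiP (e + 1) k r = ∑ q ∈ Finset.range (k + 1), f k q := fun k => by
    -- One root comes from the expansion coefficient, the other from the normalisation of `jacobiP`.
    have hs : Real.sqrt (2 * k + (e + 1 : ℕ)) * Real.sqrt (2 * k + (e + 1 : ℕ)) =
      2 * k + (e + 1 : ℕ) := Real.mul_self_sqrt (by positivity)
    rw [hf, ← Finset.mul_sum, jacobiP]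
    generalize Real.sqrt (2 * k + (e + 1 : ℕ)) = s at hs ⊢
    rw [← hs]
    ring
  simp only [h1]
  -- Collect the coefficient of `r^q`. With `k = q + j` and `n = q + N` it is a multiple of the
  -- alternating sum with `a = 2q + e`, so only `q = n` survives.
  rw [Finset.sum_comm' (t' := Finset.range (n + 1)) (s' := fun q => Finset.Ico q (n + 1))
    (by intro k q; simp only [Finset.mem_range, Finset.mem_Ico]; omega)]
  have h2 : ∀ q ∈ Finset.range (n + 1), ∑ k ∈ Finset.Ico q (n + 1), f k q =
      if q = n then (n + (e + 1 : ℕ)) * r ^ n else 0 := fun q hq => by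
    obtain ⟨N, rfl⟩ := Nat.exists_eq_add_of_le (Nat.le_of_lt_succ (Finset.mem_range.1 hq))
    rw [Finset.sum_Ico_eq_sum_range, show q + N + 1 - q = N + 1 by omega]
    have h3 : ∀ j ∈ Finset.range (N + 1), f (q + j) q =
        ((q + N + (e + 1)).factorial * (q + N).factorial /
          (q.factorial * (q + e).factorial) * r ^ q) *
        ((-1) ^ j * (2 * j + (2 * q + e : ℕ) + 1 : ℝ) * (2 * q + e + j).factorial /
          ((2 * q + e + 1 + N + j).factorial * (N - j).factorial * j.factorial)) := fun j hj => by
      have hc := choose_mul_choose_eq (q := q) (j := j) (e := e)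
      have hsq : ((-1 : ℝ) ^ q) * (-1) ^ q = 1 := by rw [← mul_pow]; simp
      rw [hf]
      simp only
      rw [show q + j + q + (e + 1) - 1 = q + j + q + e by omega,
        show q + N - (q + j) = N - j by omega,
        show q + N + (e + 1) + (q + j) = 2 * q + e + 1 + N + j by omega]
      calc _ = ((-1) ^ q * (-1) ^ q) * (-1) ^ j * ((2 * (q + j : ℕ) + (e + 1 : ℕ)) *
            (((q + N + (e + 1)).factorial * (q + N).factorial : ℝ) /
            ((2 * q + e + 1 + N + j).factorial * (N - j).factorial))) *
            (((q + j).choose q : ℝ) * ((q + j + q + e).choose (q + j) : ℝ)) * r ^ q := by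
              rw [pow_add]; ring
        _ = _ := by
              rw [hc, hsq]
              push_cast
              field_simp
              ring
    rw [Finset.sum_congr rfl h3, ← Finset.mul_sum, sum_alternating_factorial]
    by_cases hN : N = 0
    · subst hN
      have h4 : (q.factorial : ℝ) ≠ 0 := by exact_mod_cast Nat.factorial_ne_zero _
      have h5 : ((q + e).factorial : ℝ) ≠ 0 := by exact_mod_cast Nat.factorial_ne_zero _
      simp only [add_zero, if_true, mul_one]
      rw [show q + (e + 1) = (q + e) + 1 by omega, Nat.factorial_succ]
      push_cast
      field_simp
      ring
    · rw [if_neg hN, if_neg (by omega), mul_zero]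
  rw [Finset.sum_congr rfl h2, Finset.sum_ite_eq' (Finset.range (n + 1)) n]
  simp

lemma measurable_profile (η : Radial d) : Measurable (profile η) := (Classical.choose_spec η.2).1

lemma profile_ae_eq (η : Radial d) : (η : L2Ball d) =ᵐ[ballMeasure d] fun x => profile η ‖x‖ :=
  (Classical.choose_spec η.2).2

lemma integrable_profile (η : Radial d) :
    Integrable (fun x : Space d => profile η ‖x‖) (ballMeasure d) :=
  ((Lp.memLp (η : L2Ball d)).integrable (by norm_num)).congr (profile_ae_eq η)

lemma integrableOn_profile_mul [NeZero d] (η : Radial d) {g : ℝ → ℝ} (hg : Continuous g) :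
    IntegrableOn (fun r => profile η r * ((g r * r ^ (d - 1) : ℝ) : ℂ)) (Set.Ioo (0 : ℝ) 1) := by
  have : Nontrivial (Space d) := by
    have : Nonempty (Fin d) := ⟨⟨0, NeZero.pos d⟩⟩
    infer_instance
  have h1 := (integrableOn_fun_norm_addHaar (volume : Measure (Space d)) (f := profile η)
    (r := 1)).1 (integrable_profile η)
  rw [finrank_space] at h1
  obtain ⟨C, hC⟩ := (isCompact_Icc (a := (0 : ℝ)) (b := 1)).exists_bound_of_continuousOn
    (Complex.continuous_ofReal.comp hg).continuousOn
  have h2 := Integrable.mul_bdd h1 (Complex.continuous_ofReal.comp hg).aestronglyMeasurable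
    ((ae_restrict_mem measurableSet_Ioo).mono fun r hr => hC r (Set.Ioo_subset_Icc_self hr))
  refine Integrable.congr h2 (Eventually.of_forall fun r => ?_)
  simp
  ring

lemma continuous_jacobiP (d k : ℕ) : Continuous (jacobiP d k) := by
  unfold jacobiP
  fun_prop

/-- The weights of the `a_k(η)` are, up to the factor `-1/l`, the coefficients of `(n + d) r^n` in
the Jacobi polynomials with `n = 2l - 2`, so the sum collapses to one moment. -/
theorem eigenvalue_eq [NeZero d] {l : ℕ} (hl : 1 ≤ l) (η : Radial d) :
    eigenvalue l η =
      -(((2 * l - 2 : ℕ) + d : ℂ) / l * radialMoment d (2 * l - 2) (profile η)) := by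
  set n := 2 * l - 2 with hn
  have hl' : (l : ℂ) ≠ 0 := by exact_mod_cast (by omega : l ≠ 0)
  rw [eigenvalue, show 2 * l - 1 = n + 1 by omega]
  set c : ℕ → ℝ := fun k => (-1) ^ k * (Real.sqrt (2 * k + d) *
      (((n + d).factorial * n.factorial : ℝ) / ((n + d + k).factorial * (n - k).factorial)))
    with hc
  have h1 : ∀ k ∈ Finset.range (n + 1), (-1) ^ (k + 1) * coeff k η *
      ((Real.sqrt (2 * k + d) / l * (((n + d).factorial * n.factorial : ℝ) /
        ((n + d + k).factorial * (n - k).factorial)) : ℝ) : ℂ) =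
      -(l : ℂ)⁻¹ * ∫ r in Set.Ioo (0 : ℝ) 1,
        profile η r * ((c k * jacobiP d k r * r ^ (d - 1) : ℝ) : ℂ) := fun k _ => by
    have e : ∀ r : ℝ, profile η r * ((c k * jacobiP d k r * r ^ (d - 1) : ℝ) : ℂ) =
        (c k : ℂ) * (profile η r * ((jacobiP d k r * r ^ (d - 1) : ℝ) : ℂ)) := fun r => by
      push_cast; ring
    simp only [e]
    rw [integral_const_mul, ← coeff, hc]
    push_cast
    ring
  rw [Finset.sum_congr rfl h1, ← Finset.mul_sum, ← integral_finsetSum]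
  · have h2 : ∀ r : ℝ, ∑ k ∈ Finset.range (n + 1),
        profile η r * ((c k * jacobiP d k r * r ^ (d - 1) : ℝ) : ℂ) =
        (n + d : ℂ) * (profile η r * ((r ^ n * r ^ (d - 1) : ℝ) : ℂ)) := fun r => by
      rw [← Finset.mul_sum, ← Complex.ofReal_sum, ← Finset.sum_mul, hc, sum_jacobiP]
      push_cast
      ring
    simp only [h2]
    rw [integral_const_mul, radialMoment]
    field_simp
  · intro k _
    exact integrableOn_profile_mul η (g := fun r => c k * jacobiP d k r)
      (continuous_const.mul (continuous_jacobiP d k))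

end Radial

/-! ### The extension of the derivative to square-integrable radial perturbations -/

section Extension

open MvPolynomial

variable {d : ℕ}

/-- The function `‖x‖^n` in `L²(B)`. -/
def normPow (d n : ℕ) : L2Ball d :=
  (memLp_ball (f := fun x : Space d => ((‖x‖ ^ n : ℝ) : ℂ)) (by fun_prop)).toLp _

lemma normPow_coeFn (n : ℕ) :
    normPow d n =ᵐ[ballMeasure d] fun x => ((‖x‖ ^ n : ℝ) : ℂ) := MemLp.coeFn_toLp _

lemma integral_radial [NeZero d] {h : ℝ → ℂ}
    (hh : Integrable (fun x => h ‖x‖) (ballMeasure d)) :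
    ∫ x, h ‖x‖ ∂(ballMeasure d) = (surfMeasure d).real Set.univ * radialMoment d 0 h := by
  have h1 := integral_radial_mul_of_homogeneous (K := fun _ => (1 : ℂ)) continuous_const (n := 0)
    (by simp) hh
  simp only [mul_one] at h1
  rw [h1, radialMoment, integral_const, mul_comm]
  simp

lemma inner_normPow [NeZero d] (n : ℕ) (η : Radial d) :
    inner ℂ (normPow d n) (η : L2Ball d) =
      (surfMeasure d).real Set.univ * radialMoment d n (profile η) := by
  have e : inner ℂ (normPow d n) (η : L2Ball d) =
      ∫ x, ((‖x‖ ^ n : ℝ) : ℂ) * profile η ‖x‖ ∂(ballMeasure d) := by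
    rw [L2.inner_def]
    refine integral_congr_ae ?_
    filter_upwards [normPow_coeFn n, profile_ae_eq η] with x h1 h2
    rw [h1, h2, RCLike.inner_apply, Complex.conj_ofReal, mul_comm]
  have hi : Integrable (fun x : Space d => ((‖x‖ ^ n : ℝ) : ℂ) * profile η ‖x‖)
      (ballMeasure d) := by
    refine (integrable_profile η).bdd_mul (c := 1)
      (Continuous.aestronglyMeasurable (by fun_prop)) ?_
    filter_upwards [ae_restrict_mem measurableSet_ball] with x hx
    have hx1 : ‖x‖ < 1 := by simpa using hx
    rw [Complex.norm_real, norm_pow, norm_norm]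
    exact pow_le_one₀ (norm_nonneg _) hx1.le
  rw [e, integral_radial (h := fun r => ((r ^ n : ℝ) : ℂ) * profile η r) hi]
  congr 1
  refine integral_congr_ae (Eventually.of_forall fun r => ?_)
  push_cast
  ring

lemma norm_normPow_sq [NeZero d] (n : ℕ) :
    ‖normPow d n‖ ^ 2 = (surfMeasure d).real Set.univ * (2 * n + d : ℝ)⁻¹ := by
  have e : inner ℂ (normPow d n) (normPow d n) =
      ∫ x : Space d, ((‖x‖ ^ (2 * n) : ℝ) : ℂ) ∂(ballMeasure d) := by
    rw [L2.inner_def]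
    refine integral_congr_ae ?_
    filter_upwards [normPow_coeFn (d := d) n] with x h1
    rw [h1, RCLike.inner_apply, Complex.conj_ofReal]
    push_cast
    ring
  have h2 : radialMoment d 0 (fun r => ((r ^ (2 * n) : ℝ) : ℂ)) = ((2 * n + d : ℝ)⁻¹ : ℝ) := by
    have h3 := integral_pow_Ioo (d := d) (2 * n)
    push_cast at h3 ⊢
    rw [← h3]
    refine integral_congr_ae (Eventually.of_forall fun r => ?_)
    push_cast
    ring
  rw [integral_radial (h := fun r => ((r ^ (2 * n) : ℝ) : ℂ))
    (integrable_ball_of_continuous (by fun_prop)), h2, inner_self_eq_norm_sq_to_K] at e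
  refine Complex.ofReal_injective ?_
  rw [Complex.ofReal_pow, Complex.ofReal_mul]
  exact e

/-- The eigenvalue `λ_ℓ` as a bounded linear functional on the radial perturbations. -/
def eigenFunctional (d l : ℕ) : Radial d →L[ℂ] ℂ :=
  (-(((2 * l - 2 : ℕ) + d : ℂ) / l * (((surfMeasure d).real Set.univ)⁻¹ : ℝ))) •
    (innerSL ℂ (normPow d (2 * l - 2)) ∘L (radial d).subtypeL)

/-- Shows that `eigenvalue`, defined through a chosen profile, is linear and bounded in `η`. -/
lemma eigenFunctional_apply [NeZero d] {l : ℕ} (hl : 1 ≤ l) (η : Radial d) :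
    eigenFunctional d l η = eigenvalue l η := by
  have hs : (((surfMeasure d).real Set.univ : ℝ) : ℂ) ≠ 0 := by
    exact_mod_cast (surfMeasure_real_pos d).ne'
  have h : eigenFunctional d l η =
      (-(((2 * l - 2 : ℕ) + d : ℂ) / l * (((surfMeasure d).real Set.univ)⁻¹ : ℝ))) *
        inner ℂ (normPow d (2 * l - 2)) (η : L2Ball d) := rfl
  rw [h, inner_normPow, eigenvalue_eq hl, Complex.ofReal_inv]
  generalize (((surfMeasure d).real Set.univ : ℝ) : ℂ) = s at hs
  field_simp

/-- The factor `(2l-2+d)/l` is at most `2 + d`; all decay, of order `l^(-1/2)`, comes from the `L²`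
norm of `‖x‖^(2l-2)`. -/
lemma norm_eigenFunctional_le [NeZero d] {l : ℕ} (hl : 1 ≤ l) :
    ‖eigenFunctional d l‖ ≤ (2 + d) * ((surfMeasure d).real Set.univ)⁻¹ *
      Real.sqrt ((surfMeasure d).real Set.univ * (2 * (2 * l - 2 : ℕ) + d : ℝ)⁻¹) := by
  have hs := surfMeasure_real_pos d
  have hl' : (1 : ℝ) ≤ l := by exact_mod_cast hl
  rw [eigenFunctional, norm_smul, norm_neg, ← norm_normPow_sq, Real.sqrt_sq (norm_nonneg _)]
  gcongr
  · rw [norm_mul, Complex.norm_real, Real.norm_eq_abs, abs_of_pos (inv_pos.2 hs)]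
    gcongr
    rw [norm_div, ← Nat.cast_add, Complex.norm_natCast, Complex.norm_natCast,
      div_le_iff₀ (by linarith)]
    have h1 : ((2 * l - 2 + d : ℕ) : ℝ) ≤ 2 * l + d := by
      have : 2 * l - 2 + d ≤ 2 * l + d := by omega
      exact_mod_cast this
    have h2 : (0 : ℝ) ≤ d := by positivity
    nlinarith
  · refine (ContinuousLinearMap.opNorm_comp_le _ _).trans ?_
    rw [innerSL_apply_norm]
    exact mul_le_of_le_one_right (norm_nonneg _) (Submodule.norm_subtypeL_le _)

lemma tendsto_norm_eigenFunctional (d : ℕ) [NeZero d] :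
    Tendsto (fun l => ‖eigenFunctional d l‖) atTop (𝓝 0) := by
  have h1 : Tendsto (fun l : ℕ => (2 * (2 * l - 2 : ℕ) + d : ℝ)) atTop atTop := by
    refine tendsto_atTop_mono' atTop ?_ tendsto_natCast_atTop_atTop
    filter_upwards [eventually_ge_atTop 4] with l hl
    have : l ≤ 2 * (2 * l - 2) + d := by omega
    exact_mod_cast this
  have h2 := ((Real.continuous_sqrt.tendsto _).comp
    (h1.inv_tendsto_atTop.const_mul ((surfMeasure d).real Set.univ))).const_mul
      ((2 + d) * ((surfMeasure d).real Set.univ)⁻¹ : ℝ)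
  rw [mul_zero, Real.sqrt_zero, mul_zero] at h2
  refine squeeze_zero' (Eventually.of_forall fun l => norm_nonneg _) ?_ h2
  filter_upwards [eventually_ge_atTop 1] with l hl
  exact norm_eigenFunctional_le hl

/-! ### Orthogonal sums of harmonic projections and convergence of the partial sums -/

lemma mem_sphHarmZero [NeZero d] {l : ℕ} (hl : 1 ≤ l) {g : L2SphZero d} :
    g ∈ sphHarmZero d l ↔ ∃ p, ∃ hp : p ∈ harmonicPoly d l, harmElt hl hp = g := by
  constructor
  · intro h
    obtain ⟨p, hp, h⟩ := mem_sphHarm.1 (Submodule.mem_comap.1 h)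
    exact ⟨p, hp, Subtype.ext h⟩
  · rintro ⟨p, hp, rfl⟩
    exact mem_sphHarm.2 ⟨p, hp, rfl⟩

lemma inner_eq_zero_of_mem_sphHarmZero [NeZero d] {l m : ℕ} (hlm : l ≠ m) {f g : L2SphZero d}
    (hf : f ∈ sphHarmZero d l) (hg : g ∈ sphHarmZero d m) : inner ℂ f g = 0 := by
  obtain ⟨p, hp, h1⟩ := mem_sphHarm.1 (Submodule.mem_comap.1 hf)
  obtain ⟨q, hq, h2⟩ := mem_sphHarm.1 (Submodule.mem_comap.1 hg)
  change inner ℂ ((meanZero d).subtype f) ((meanZero d).subtype g) = 0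
  rw [← h1, ← h2]
  exact inner_sphPoly_of_ne hlm.symm hq hp

lemma harmProj_apply_mem (l : ℕ) (f : L2SphZero d) : harmProj d l f ∈ sphHarmZero d l :=
  Submodule.starProjection_apply_mem _ _

lemma orthogonalFamily_sphHarmZero (d : ℕ) [NeZero d] :
    OrthogonalFamily ℂ (fun l => sphHarmZero d l) fun l => (sphHarmZero d l).subtypeₗᵢ :=
  fun _ _ hlm f g => inner_eq_zero_of_mem_sphHarmZero hlm f.2 g.2

lemma norm_sum_smul_harmProj_sq [NeZero d] (s : Finset ℕ) (c : ℕ → ℂ) (f : L2SphZero d) :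
    ‖∑ l ∈ s, c l • harmProj d l f‖ ^ 2 = ∑ l ∈ s, ‖c l‖ ^ 2 * ‖harmProj d l f‖ ^ 2 := by
  have h := (orthogonalFamily_sphHarmZero d).norm_sum
    (fun l => c l • (⟨harmProj d l f, harmProj_apply_mem l f⟩ : sphHarmZero d l)) s
  simpa [norm_smul, mul_pow] using h

/-- Bessel's inequality: the partial sum `g` satisfies `Re⟨g, f⟩ = ‖g‖²`, so `‖g‖ ≤ ‖f‖` by
Cauchy–Schwarz. -/
lemma sum_norm_harmProj_sq_le [NeZero d] (s : Finset ℕ) (f : L2SphZero d) :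
    ∑ l ∈ s, ‖harmProj d l f‖ ^ 2 ≤ ‖f‖ ^ 2 := by
  have h1 := norm_sum_smul_harmProj_sq s (fun _ => 1) f
  simp only [one_smul, norm_one, one_pow, one_mul] at h1
  rw [← h1]
  set g := ∑ l ∈ s, harmProj d l f with hg
  have h2 : RCLike.re (inner ℂ g f) = ‖g‖ ^ 2 := by
    rw [h1, hg, sum_inner, map_sum]
    exact Finset.sum_congr rfl fun l _ => Submodule.re_inner_starProjection_eq_normSq _ f
  have h3 : ‖g‖ ^ 2 ≤ ‖g‖ * ‖f‖ := h2 ▸ re_inner_le_norm g f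
  have h4 : ‖g‖ ≤ ‖f‖ := by
    by_contra! h
    nlinarith [norm_nonneg f]
  gcongr

/-- Pythagoras and Bessel: orthogonal ranges let the largest coefficient, rather than the sum of the
coefficients, control the norm. -/
lemma norm_sum_smul_harmProj_le [NeZero d] {s : Finset ℕ} {c : ℕ → ℂ} {ε : ℝ} (hε : 0 ≤ ε)
    (hc : ∀ l ∈ s, ‖c l‖ ≤ ε) : ‖∑ l ∈ s, c l • harmProj d l‖ ≤ ε := by
  refine ContinuousLinearMap.opNorm_le_bound _ hε fun f => ?_
  refine le_of_sq_le_sq ?_ (by positivity)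
  simp only [sum_apply, smul_apply]
  rw [norm_sum_smul_harmProj_sq, mul_pow]
  refine le_trans (Finset.sum_le_sum fun l hl => ?_)
    ((Finset.mul_sum _ _ _).symm.le.trans
      (mul_le_mul_of_nonneg_left (sum_norm_harmProj_sq_le s f) (sq_nonneg ε)))
  gcongr
  exact hc l hl

/-- The partial sums `F_N`. -/
def partialSum (d N : ℕ) : Radial d →L[ℂ] (L2SphZero d →L[ℂ] L2SphZero d) :=
  ∑ l ∈ Finset.Icc 1 N, (eigenFunctional d l).smulRight (harmProj d l)

lemma partialSum_apply (N : ℕ) (η : Radial d) :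
    partialSum d N η = ∑ l ∈ Finset.Icc 1 N, eigenFunctional d l η • harmProj d l := by
  simp [partialSum]

lemma partialSum_apply_eq_eigenvalue [NeZero d] (N : ℕ) (η : Radial d) :
    partialSum d N η = ∑ l ∈ Finset.Icc 1 N, eigenvalue l η • harmProj d l := by
  rw [partialSum_apply]
  exact Finset.sum_congr rfl fun l hl => by
    rw [eigenFunctional_apply (Finset.mem_Icc.1 hl).1]

lemma finiteDimensional_range_partialSum (d N : ℕ) :
    FiniteDimensional ℂ (partialSum d N).range := by
  have hle : (partialSum d N).range ≤
      Submodule.span ℂ (Set.range fun l : Finset.Icc 1 N => harmProj d l) := by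
    rintro _ ⟨η, rfl⟩
    change partialSum d N η ∈ _
    rw [partialSum_apply]
    exact Submodule.sum_mem _ fun l hl =>
      Submodule.smul_mem _ _ (Submodule.subset_span ⟨⟨l, hl⟩, rfl⟩)
  have : FiniteDimensional ℂ
      (Submodule.span ℂ (Set.range fun l : Finset.Icc 1 N => harmProj d l)) :=
    FiniteDimensional.span_of_finite ℂ (Set.finite_range _)
  exact Submodule.finiteDimensional_of_le hle

/-- Because only the largest coefficient matters, `‖λ_l‖ → 0` suffices; the norms, bounded only by
order `l^(-1/2)`, need not be summable. -/
lemma cauchySeq_partialSum (d : ℕ) [NeZero d] : CauchySeq (partialSum d) := by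
  rw [Metric.cauchySeq_iff']
  intro ε hε
  obtain ⟨N, hN⟩ := Metric.tendsto_atTop.1 (tendsto_norm_eigenFunctional d) (ε / 2) (by positivity)
  refine ⟨N, fun M hM => ?_⟩
  rw [dist_eq_norm]
  refine lt_of_le_of_lt (ContinuousLinearMap.opNorm_le_bound _ (by positivity) fun η => ?_)
    (half_lt_self hε)
  have h1 : (partialSum d M - partialSum d N) η =
      ∑ l ∈ Finset.Icc 1 M \ Finset.Icc 1 N, eigenFunctional d l η • harmProj d l := by
    rw [sub_apply, partialSum_apply, partialSum_apply,
      ← Finset.sum_sdiff (Finset.Icc_subset_Icc_right hM), add_sub_cancel_right]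
  rw [h1]
  refine norm_sum_smul_harmProj_le (by positivity) fun l hl => ?_
  have hl' : N ≤ l := by
    simp only [Finset.mem_sdiff, Finset.mem_Icc] at hl
    omega
  have h2 := hN l hl'
  rw [dist_zero_right, norm_norm] at h2
  exact (ContinuousLinearMap.le_opNorm _ _).trans (by gcongr)

/-! ### Identification of the limit with the derivative -/

lemma harmProj_harmElt_self [NeZero d] {l : ℕ} (hl : 1 ≤ l) {p : MvPolynomial (Fin d) ℂ}
    (hp : p ∈ harmonicPoly d l) : harmProj d l (harmElt hl hp) = harmElt hl hp :=
  Submodule.starProjection_eq_self_iff.2 ((mem_sphHarmZero hl).2 ⟨p, hp, rfl⟩)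

lemma harmProj_harmElt_of_ne [NeZero d] {l m : ℕ} (hlm : m ≠ l) (hl : 1 ≤ l)
    {p : MvPolynomial (Fin d) ℂ} (hp : p ∈ harmonicPoly d l) :
    harmProj d m (harmElt hl hp) = 0 := by
  refine (Submodule.starProjection_apply_eq_zero_iff _).2 ?_
  rw [Submodule.mem_orthogonal]
  exact fun u hu => inner_eq_zero_of_mem_sphHarmZero hlm hu ((mem_sphHarmZero hl).2 ⟨p, hp, rfl⟩)

lemma partialSum_harmElt [NeZero d] {l N : ℕ} (hl : 1 ≤ l) (hN : l ≤ N)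
    {p : MvPolynomial (Fin d) ℂ} (hp : p ∈ harmonicPoly d l) (η : Radial d) :
    partialSum d N η (harmElt hl hp) = eigenvalue l η • harmElt hl hp := by
  rw [partialSum_apply_eq_eigenvalue, sum_apply,
    Finset.sum_eq_single_of_mem l (Finset.mem_Icc.2 ⟨hl, hN⟩)]
  · rw [smul_apply, harmProj_harmElt_self]
  · intro m _ hm
    rw [smul_apply, harmProj_harmElt_of_ne hm, smul_zero]

lemma sphPoly_of_degree_zero {p : MvPolynomial (Fin d) ℂ} (hp : p ∈ harmonicPoly d 0) :
    ∃ a : ℂ, sphPoly d p = a • Lp.const 2 (surfMeasure d) (1 : ℂ) := by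
  have h := (mem_harmonicPoly.1 hp).1
  obtain ⟨a, rfl⟩ : ∃ a, p = C a :=
    ⟨_, totalDegree_eq_zero_iff_eq_C.1 (Nat.le_zero.1 h.totalDegree_le)⟩
  refine ⟨a, Lp.ext ?_⟩
  filter_upwards [sphPoly_coeFn (C a : MvPolynomial (Fin d) ℂ),
    Lp.coeFn_smul a (Lp.const 2 (surfMeasure d) (1 : ℂ)),
    Lp.coeFn_const 2 (surfMeasure d) (1 : ℂ)] with θ h1 h2 h3
  rw [h1, h2, Pi.smul_apply, h3]
  simp [polyFun]

/-- The spherical harmonics of positive degree are complete in `L²_⋄(∂B)`. -/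
lemma eq_zero_of_inner_harmElt [NeZero d] {g : L2SphZero d}
    (h : ∀ l (hl : 1 ≤ l) p (hp : p ∈ harmonicPoly d l), inner ℂ g (harmElt hl hp) = 0) :
    g = 0 := by
  refine Subtype.ext (eq_zero_of_inner_sphPoly fun l p hp => ?_)
  rcases Nat.eq_zero_or_pos l with rfl | hl
  · obtain ⟨a, ha⟩ := sphPoly_of_degree_zero hp
    rw [ha, inner_smul_right, (Submodule.mem_orthogonal_singleton_iff_inner_left).1 g.2, mul_zero]
  · exact h l hl p hp

/-- Every value of the adjoint of `A - A'` is orthogonal to all spherical harmonics of positive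
degree, hence zero by completeness. -/
lemma clm_ext_harmElt [NeZero d] {A A' : L2SphZero d →L[ℂ] L2SphZero d}
    (h : ∀ l (hl : 1 ≤ l) p (hp : p ∈ harmonicPoly d l),
      A (harmElt hl hp) = A' (harmElt hl hp)) : A = A' := by
  rw [← sub_eq_zero]
  set D := A - A' with hD
  have hadj : D.adjoint = 0 := by
    ext1 g
    refine eq_zero_of_inner_harmElt fun l hl p hp => ?_
    rw [ContinuousLinearMap.adjoint_inner_left, hD, sub_apply, h l hl p hp,
      sub_self, inner_zero_right]
  rw [← ContinuousLinearMap.adjoint_adjoint D, hadj, map_zero]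

lemma fderiv_ndMap_harmElt [NeZero d] {η : Radial d} {ζ : LinfBall d}
    (h : (η : L2Ball d) =ᵐ[ballMeasure d] ζ) {l : ℕ} (hl : 1 ≤ l)
    {p : MvPolynomial (Fin d) ℂ} (hp : p ∈ harmonicPoly d l) :
    fderiv ℂ (ndMap d) (oneCond d) ζ (harmElt hl hp) = eigenvalue l η • harmElt hl hp := by
  rw [← sub_eq_zero]
  refine eq_zero_of_inner_harmElt fun m hm q hq => ?_
  have hζ : ζ =ᵐ[ballMeasure d] fun x => profile η ‖x‖ := h.symm.trans (profile_ae_eq η)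
  rw [← inner_conj_symm, inner_sub_right, inner_smul_right,
    inner_fderiv_ndMap_harmElt hζ hl hm hp hq, eigenvalue_eq hl, sub_self, map_zero]

/-- On a harmonic of degree `l` the partial sums are constant from `N = l` on, with the same
eigenvalue as the derivative. -/
lemma extendsDerivative_of_tendsto [NeZero d]
    {F : Radial d →L[ℂ] (L2SphZero d →L[ℂ] L2SphZero d)}
    (hF : Tendsto (partialSum d) atTop (𝓝 F)) : ExtendsDerivative F := by
  intro η ζ h
  refine clm_ext_harmElt fun l hl p hp => ?_
  rw [fderiv_ndMap_harmElt h hl hp]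
  have h1 : Tendsto (fun N => partialSum d N η (harmElt hl hp)) atTop
      (𝓝 (F η (harmElt hl hp))) :=
    (((ContinuousLinearMap.apply ℂ _ (harmElt hl hp)).continuous.comp
      (ContinuousLinearMap.apply ℂ _ η).continuous).tendsto F).comp hF
  refine tendsto_nhds_unique h1 (tendsto_const_nhds.congr' ?_)
  filter_upwards [eventually_ge_atTop l] with N hN
  rw [partialSum_harmElt hl hN hp]

/-! ### Density of bounded radial perturbations, uniqueness and compactness -/

/-- Every radial perturbation can be approximated by bounded ones. -/
lemma exists_bounded_radial_near (η : Radial d) {ε : ℝ} (hε : 0 < ε) :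
    ∃ (η' : Radial d) (ζ : LinfBall d), (η' : L2Ball d) =ᵐ[ballMeasure d] ζ ∧ ‖η - η'‖ ≤ ε := by
  have hm := measurable_profile η
  set f : Space d → ℂ := fun x => profile η ‖x‖ with hf
  have hfm : Measurable f := hm.comp measurable_norm
  have hf2 : MemLp f 2 (ballMeasure d) := (memLp_congr_ae (profile_ae_eq η)).1 (Lp.memLp _)
  -- A level `M` above which `f` carries `L²` norm at most `ε`. The truncation is made on the
  -- profile, so the approximant stays radial.
  obtain ⟨M, hM⟩ := hf2.eLpNorm_indicator_norm_ge_le hfm.stronglyMeasurable hε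
  set S : Set ℝ := {r | ‖profile η r‖ < M} with hS
  have hSm : MeasurableSet S := measurableSet_lt hm.norm measurable_const
  set k : ℝ → ℂ := S.indicator (profile η) with hk
  have hkm : Measurable k := hm.indicator hSm
  have hkb : ∀ r, ‖k r‖ ≤ |M| := fun r => by
    by_cases hr : r ∈ S
    · rw [hk, Set.indicator_of_mem hr]
      exact (le_of_lt hr).trans (le_abs_self M)
    · rw [hk, Set.indicator_of_notMem hr, norm_zero]
      exact abs_nonneg M
  have hmem : ∀ q : ℝ≥0∞, MemLp (fun x : Space d => k ‖x‖) q (ballMeasure d) := fun q =>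
    MemLp.of_bound (hkm.comp measurable_norm).aestronglyMeasurable |M|
      (Eventually.of_forall fun x => hkb ‖x‖)
  refine ⟨⟨(hmem 2).toLp _, k, hkm, MemLp.coeFn_toLp _⟩, (hmem ∞).toLp _,
    (MemLp.coeFn_toLp (hmem 2)).trans (MemLp.coeFn_toLp (hmem ∞)).symm, ?_⟩
  change ‖(η : L2Ball d) - (hmem 2).toLp _‖ ≤ ε
  rw [Lp.norm_def]
  refine ENNReal.toReal_le_of_le_ofReal hε.le (le_trans (le_of_eq (eLpNorm_congr_ae ?_)) hM)
  filter_upwards [Lp.coeFn_sub (η : L2Ball d) ((hmem 2).toLp _), profile_ae_eq η,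
    MemLp.coeFn_toLp (hmem 2)] with x h1 h2 h3
  rw [h1, Pi.sub_apply, h2, h3, hk]
  by_cases hx : ‖profile η ‖x‖‖ < M
  · rw [Set.indicator_of_mem (show ‖x‖ ∈ S from hx), Set.indicator_of_notMem, sub_self]
    simpa [hf] using hx
  · rw [Set.indicator_of_notMem (show ‖x‖ ∉ S from hx), Set.indicator_of_mem, sub_zero]
    simpa [hf] using hx

lemma ExtendsDerivative.unique {F F' : Radial d →L[ℂ] (L2SphZero d →L[ℂ] L2SphZero d)}
    (h : ExtendsDerivative F) (h' : ExtendsDerivative F') : F' = F := by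
  ext1 η
  have hcl : IsClosed {η : Radial d | F' η = F η} := isClosed_eq F'.continuous F.continuous
  refine hcl.closure_subset_iff.2 subset_rfl (Metric.mem_closure_iff.2 fun ε hε => ?_)
  obtain ⟨η', ζ, h1, h2⟩ := exists_bounded_radial_near η (half_pos hε)
  refine ⟨η', (h' η' ζ h1).trans (h η' ζ h1).symm, ?_⟩
  rw [dist_eq_norm]
  linarith

lemma isCompactOperator_partialSum (d N : ℕ) : IsCompactOperator (partialSum d N) := by
  have := finiteDimensional_range_partialSum d N
  have := FiniteDimensional.proper ℂ (partialSum d N).range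
  have h : IsCompactOperator (partialSum d N).rangeRestrict :=
    isCompactOperator_of_locallyCompactSpace_dom _
  exact h.clm_comp (partialSum d N).range.subtypeL

end Extension

end EIT

end

theorem corollary2p2 (d : ℕ) (hd : 2 ≤ d) :
    DifferentiableAt ℂ (EIT.ndMap d) (EIT.oneCond d) ∧
    ∃ F : EIT.Radial d →L[ℂ] (EIT.L2SphZero d →L[ℂ] EIT.L2SphZero d),
      EIT.ExtendsDerivative F ∧
      (∀ F' : EIT.Radial d →L[ℂ] (EIT.L2SphZero d →L[ℂ] EIT.L2SphZero d),
        EIT.ExtendsDerivative F' → F' = F) ∧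
      (∃ FN : ℕ → (EIT.Radial d →L[ℂ] (EIT.L2SphZero d →L[ℂ] EIT.L2SphZero d)),
        (∀ (N : ℕ) (η : EIT.Radial d),
          FN N η = ∑ l ∈ Finset.Icc 1 N, EIT.eigenvalue l η • EIT.harmProj d l) ∧
        (∀ N : ℕ, FiniteDimensional ℂ (FN N).range) ∧
        Tendsto (fun N => ‖F - FN N‖) atTop (𝓝 0)) ∧
      IsCompactOperator F := by
  have : NeZero d := ⟨by omega⟩
  have := EIT.completeSpace_L2SphZero d
  -- `F` is constructed as the norm limit of the `F_N`, so convergence and compactness are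
  -- immediate; only agreement with the derivative needs an argument.
  obtain ⟨F, hF⟩ := cauchySeq_tendsto_of_complete (EIT.cauchySeq_partialSum d)
  have hext := EIT.extendsDerivative_of_tendsto hF
  refine ⟨(EIT.hasFDerivAt_ndMap d).differentiableAt, F, hext, fun F' hF' => hext.unique hF',
    ⟨EIT.partialSum d, EIT.partialSum_apply_eq_eigenvalue,
      EIT.finiteDimensional_range_partialSum d, ?_⟩,
    isCompactOperator_of_tendsto hF (Eventually.of_forall (EIT.isCompactOperator_partialSum d))⟩
  have h := (tendsto_const_nhds.sub hF : Tendsto (fun N => F - EIT.partialSum d N) _ _).norm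
  simpa using h
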